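/- Let $\mathbb{R}^{4,2}$ carry its inner product $(\cdot,\cdot)$ of signature $(++++--)$. Let $\mathfrak p$ be a point sphere complex, $(\mathfrak p,\mathfrak p)=-1$, and $\mathfrak q\perp\mathfrak p$ a space form vector with $(\mathfrak q,\mathfrak q)\neq 0$, so that they define a space form $\{v \text{ lightlike}: (v,\mathfrak p)=0,\ (v,\mathfrak q)=-1\}$ of curvature $-(\mathfrak q,\mathfrak q)\ne0$. Let $(\Lambda,\mathfrak p^\pm)$ be a linear Weingarten surface with real sphere complexes in it: $\Lambda$ is the Legendre lift of a surface in the space form, it is spanned by two real isothermic sphere congruences $s^\pm$ that separate its curvature spheres harmonically, $s^\pm$ takes values in the linear sphere complex $\mathfrak p^\pm$ (i.e. $s^\pm\perp \mathfrak p^\pm$), and $\operatorname{span}\{\mathfrak p^+,\mathfrak p^-\}=\operatorname{span}\{\mathfrak p,\mathfrak q\}$. Put $$\kappa^\pm=(\mathfrak p^\pm,\mathfrak p^\pm),\qquad \varepsilon=(\mathfrak p^+,\mathfrak p^-),\qquad \Delta=\kappa^+\kappa^--\varepsilon^2,$$ and assume $\kappa^-\neq0$. Suppose that $\Lambda$,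 with parameters $(\theta,t)\in\mathbb{R}\times I$, $I$ a non-empty open interval, is rotational with respect to the group $\rho_1$ of non-parabolic rotations in a plane $\Pi_1\perp \mathfrak p,\mathfrak q$: it is spanned by two sphere congruences of the form $\rho_1(\theta)c(t)$ with $c$ perpendicular to $e_1$, where $\{v_i,e_i\}$ ($i=1,2$) denotes an orthogonal basis of $\Pi_1$ and of $\Pi_2=(\Pi_1\oplus\operatorname{span}\{\mathfrak p,\mathfrak q\})^\perp$, respectively, with $(e_i,e_i)=1$ and $(v_i,v_i)=\kappa_i\in\{1,-1\}$, and $\rho_1$ has unit speed ($v_1\mapsto \cos\theta\, v_1+\sin\theta\, e_1$ or $v_1\mapsto\cosh\theta\, v_1+\sinh\theta\, e_1$). Assume that the $\Pi_2$-component of $s^+$ has everywhere the same strict causal character as $v_2$ (in particular it does not vanish). Then $s^\pm$ have smooth Christoffel dual lifts $\mathfrak s^\pm$ with $(\mathfrak s^\pm,\mathfrak p^\pm)=0$ and $(\mathfrak s^\pm,\mathfrak p^\mp)=\Delta$, and there are a constant $C\in\mathbb{R}$ and an orientation preserving smooth reparametrization of the profile curve, after which the new parameter (again called $t$, and ranging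 over an open interval) satisfies $$|\mathfrak s^+_\theta|^2=|\mathfrak s^+_t|^2\neq 0,\qquad \mathfrak s^-_\theta=C\,\frac{\mathfrak s^+_\theta}{|\mathfrak s^+_\theta|^2},\qquad \mathfrak s^-_t=-C\,\frac{\mathfrak s^+_t}{|\mathfrak s^+_t|^2},$$ and there are smooth real functions $r,\psi,d$ of $t$ such that, for one of the two orientations of the unit speed group $\rho_2$ of rotations in $\Pi_2$, $$\mathfrak s^+(\theta,t)=\rho_1(\theta)\,\rho_2(\psi(t))\bigl(-\varepsilon\,\mathfrak p^++\kappa^+\,\mathfrak p^-+r(t)\,v_1+d(t)\,v_2\bigr)$$ and $$(r')^2=\frac{\kappa^-}{\Delta^2}(r^2-C_1)(r^2-C_2),\qquad \psi'=\sqrt{\frac{\kappa_1\kappa_2}{\Delta}}\;\frac{\varepsilon r^2+\kappa^+C}{\kappa^+\Delta+\kappa_1r^2},\qquad d^2=-\frac{\kappa^+\Delta+\kappa_1r^2}{\kappa_2},$$ where $\kappa^+\Delta+\kappa_1 r^2$ has no zeros and $C_1,C_2$ are the (complex) roots, with multiplicity, of the quadratic polynomial $$p_C(x)=\kappa_1\kappa^-x^2+(\Delta^2+2\kappa_1\varepsilon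 C)x+\kappa_1\kappa^+C^2 .$$ The roots $C_1,C_2$ are real unless $\kappa^+$ and $\kappa^-$ are both positive. -/

import Mathlib

open scoped ContDiff

noncomputable section

namespace LieSphere

/-- The vector space underlying `ℝ^{4,2}`. -/
abbrev R42 : Type := Fin 6 → ℝ

/-- The inner product of signature `(++++--)` on `ℝ^{4,2}`. -/
def ip (x y : R42) : ℝ :=
  -(x 0 * y 0) + x 1 * y 1 + x 2 * y 2 + x 3 * y 3 + x 4 * y 4 - x 5 * y 5

/-- `p` is a point sphere complex and `q` a space form vector; the space form they define,
`{v lightlike | (v,p) = 0, (v,q) = -1}`, has constant sectional curvature `-(q,q)`. -/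
structure IsSpaceForm (p q : R42) : Prop where
  unit_timelike : ip p p = -1
  perp : ip p q = 0

/-! ### Rotations -/

/-- `cos` for `κ > 0` (elliptic case), `cosh` otherwise (hyperbolic case). -/
def kcos (κ θ : ℝ) : ℝ := if 0 < κ then Real.cos θ else Real.cosh θ

/-- `sin` for `κ > 0` (elliptic case), `sinh` otherwise (hyperbolic case). -/
def ksin (κ θ : ℝ) : ℝ := if 0 < κ then Real.sin θ else Real.sinh θ

/-- `v, e` is an orthonormal basis of a non-degenerate plane perpendicular to `p` and `q`, where
`e` is unit spacelike and `(v,v) = κ = ±1` carries the signature of the plane. -/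
structure IsRotationPlane (p q v e : R42) (κ : ℝ) : Prop where
  sign : κ = 1 ∨ κ = -1
  vv : ip v v = κ
  ee : ip e e = 1
  ve : ip v e = 0
  vp : ip v p = 0
  vq : ip v q = 0
  ep : ip e p = 0
  eq : ip e q = 0

/-- The component in the plane spanned by `v, e` with respect to the orthogonal splitting, for
`(v,v) = κ = ±1`, `(e,e) = 1`, `(v,e) = 0`. -/
def planePart (v e : R42) (κ : ℝ) (x : R42) : R42 := (κ * ip x v) • v + ip x e • e

/-- The one-parameter group of rotations in the plane spanned by `v, e` (where `(v,v) = κ = ±1`,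
`(e,e) = 1`, `(v,e) = 0`): it is the identity on the orthogonal complement of the plane, and
`v ↦ cos θ v + sin θ e`, `e ↦ -sin θ v + cos θ e` if `κ = 1`,
`v ↦ cosh θ v + sinh θ e`, `e ↦ sinh θ v + cosh θ e` if `κ = -1`. -/
def rot (v e : R42) (κ θ : ℝ) (x : R42) : R42 :=
  (x - planePart v e κ x)
    + (κ * ip x v) • (kcos κ θ • v + ksin κ θ • e)
    + ip x e • (kcos κ θ • e - (κ * ksin κ θ) • v)

/-! ### Sphere congruences and Legendre immersions

Maps are defined on an open subset `D` of the parameter plane; values outside `D` are irrelevant.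
-/

/-- `σ` is a (smooth) lift of the sphere congruence `s` on `D`. -/
structure IsLift (D : Set (ℝ × ℝ)) (s : ℝ × ℝ → Submodule ℝ R42) (σ : ℝ × ℝ → R42) : Prop where
  smooth : ContDiffOn ℝ ∞ σ D
  ne_zero : ∀ x ∈ D, σ x ≠ 0
  lightlike : ∀ x ∈ D, ip (σ x) (σ x) = 0
  spans : ∀ x ∈ D, s x = Submodule.span ℝ {σ x}

/-- `s` is a (smooth) map into the Lie quadric, the projective light cone. -/
def IsSphereCongruence (D : Set (ℝ × ℝ)) (s : ℝ × ℝ → Submodule ℝ R42) : Prop :=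
  ∃ σ, IsLift D s σ

/-- `σ` is a smooth section on `D` of the bundle `Λ`. -/
structure IsSection (D : Set (ℝ × ℝ)) (Λ : ℝ × ℝ → Submodule ℝ R42) (σ : ℝ × ℝ → R42) :
    Prop where
  smooth : ContDiffOn ℝ ∞ σ D
  mem : ∀ x ∈ D, σ x ∈ Λ x

/-- `Λ` is a Legendre immersion: a smooth family of null planes that satisfies the contact
condition and the immersion condition. -/
structure IsLegendreImmersion (D : Set (ℝ × ℝ)) (Λ : ℝ × ℝ → Submodule ℝ R42) : Prop where
  frame : ∃ σ₁ σ₂ : ℝ × ℝ → R42, ContDiffOn ℝ ∞ σ₁ D ∧ ContDiffOn ℝ ∞ σ₂ D ∧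
    ∀ x ∈ D, LinearIndependent ℝ ![σ₁ x, σ₂ x] ∧ Λ x = Submodule.span ℝ {σ₁ x, σ₂ x}
  null : ∀ x ∈ D, ∀ a ∈ Λ x, ∀ b ∈ Λ x, ip a b = 0
  contact : ∀ a b, IsSection D Λ a → IsSection D Λ b →
    ∀ x ∈ D, ∀ X : ℝ × ℝ, ip (fderiv ℝ a x X) (b x) = 0
  immersion : ∀ x ∈ D, ∀ X : ℝ × ℝ,
    (∀ a, IsSection D Λ a → fderiv ℝ a x X ∈ Λ x) → X = 0

/-- The line spanned by `w` is the curvature sphere of `Λ` at `x` for the direction `X`. -/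
def IsCurvatureSphereAt (D : Set (ℝ × ℝ)) (Λ : ℝ × ℝ → Submodule ℝ R42) (x X : ℝ × ℝ)
    (w : R42) : Prop :=
  w ≠ 0 ∧ ∃ a, IsSection D Λ a ∧ a x = w ∧ fderiv ℝ a x X ∈ Λ x

/-- `s₁, s₂` separate the curvature spheres of `Λ` harmonically at `x`: the curvature spheres
are spanned by `a + b` and `a - b`, for some `0 ≠ a ∈ s₁`, `0 ≠ b ∈ s₂`. -/
def SeparatesHarmonicallyAt (D : Set (ℝ × ℝ)) (Λ s₁ s₂ : ℝ × ℝ → Submodule ℝ R42)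
    (x : ℝ × ℝ) : Prop :=
  ∃ a ∈ s₁ x, ∃ b ∈ s₂ x, a ≠ 0 ∧ b ≠ 0 ∧ ∃ X Y : ℝ × ℝ, LinearIndependent ℝ ![X, Y] ∧
    IsCurvatureSphereAt D Λ x X (a + b) ∧ IsCurvatureSphereAt D Λ x Y (a - b)

/-- Partial derivative with respect to the first coordinate. -/
def pd1 (f : ℝ × ℝ → R42) (x : ℝ × ℝ) : R42 := fderiv ℝ f x (1, 0)

/-- Partial derivative with respect to the second coordinate. -/
def pd2 (f : ℝ × ℝ → R42) (x : ℝ × ℝ) : R42 := fderiv ℝ f x (0, 1)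

/-- The sphere congruence `s` is isothermic: around every point there are coordinates `(u,v)`
(given by `e`) and a Moutard lift `σ`, that is, `σ_uv ∥ σ`. -/
def IsIsothermic (D : Set (ℝ × ℝ)) (s : ℝ × ℝ → Submodule ℝ R42) : Prop :=
  ∀ x ∈ D, ∃ e : OpenPartialHomeomorph (ℝ × ℝ) (ℝ × ℝ), x ∈ e.source ∧ e.source ⊆ D ∧
    ContDiffOn ℝ ∞ e e.source ∧ ContDiffOn ℝ ∞ e.symm e.target ∧
    ∃ σ, IsLift e.source s σ ∧
      ∀ y ∈ e.target, ∃ c : ℝ, pd1 (pd2 (σ ∘ e.symm)) y = c • σ (e.symm y)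

/-- `Λ` is an Ω-surface with the (real) pair `s₁, s₂` of isothermic sphere congruences. -/
structure IsOmegaSurface (D : Set (ℝ × ℝ)) (Λ s₁ s₂ : ℝ × ℝ → Submodule ℝ R42) : Prop where
  legendre : IsLegendreImmersion D Λ
  congruence₁ : IsSphereCongruence D s₁
  congruence₂ : IsSphereCongruence D s₂
  spanned : ∀ x ∈ D, Λ x = s₁ x ⊔ s₂ x
  isothermic₁ : IsIsothermic D s₁
  isothermic₂ : IsIsothermic D s₂
  harmonic : ∀ x ∈ D, SeparatesHarmonicallyAt D Λ s₁ s₂ x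

/-- `(Λ, p⁺, p⁻)` is a linear Weingarten surface with real sphere complexes in the space form
given by `p, q`: an Ω-surface, the Legendre lift of a surface in this space form, whose
isothermic sphere congruences `s⁺, s⁻` take values in the linear sphere complexes `p⁺, p⁻`,
which span the plane of `p` and `q`. -/
structure IsLinearWeingarten (D : Set (ℝ × ℝ)) (p q pp pm : R42)
    (Λ sp sm : ℝ × ℝ → Submodule ℝ R42) : Prop where
  omega : IsOmegaSurface D Λ sp sm
  spaceFormLift : ∃ f, IsSection D Λ f ∧ ∀ x ∈ D, ip (f x) p = 0 ∧ ip (f x) q = -1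
  complex_p : ∀ x ∈ D, ∀ w ∈ sp x, ip w pp = 0
  complex_m : ∀ x ∈ D, ∀ w ∈ sm x, ip w pm = 0
  span_eq : Submodule.span ℝ {pp, pm} = Submodule.span ℝ {p, q}

/-- `Λ` (with parameters `(θ, t) ∈ ℝ × I`) is rotational with respect to the rotations in the
plane of `v, e`: it is spanned by two rotational sphere congruences, whose profile curves
take values in the orthogonal complement of `e`. -/
def IsRotational (I : Set ℝ) (v e : R42) (κ : ℝ) (Λ : ℝ × ℝ → Submodule ℝ R42) : Prop :=
  ∃ c₁ c₂ : ℝ → R42, ContDiffOn ℝ ∞ c₁ I ∧ ContDiffOn ℝ ∞ c₂ I ∧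
    (∀ t ∈ I, c₁ t ≠ 0 ∧ ip (c₁ t) (c₁ t) = 0 ∧ ip (c₁ t) e = 0) ∧
    (∀ t ∈ I, c₂ t ≠ 0 ∧ ip (c₂ t) (c₂ t) = 0 ∧ ip (c₂ t) e = 0) ∧
    ∀ θ : ℝ, ∀ t ∈ I,
      Λ (θ, t) = Submodule.span ℝ {rot v e κ θ (c₁ t), rot v e κ θ (c₂ t)}

/-- The lifts `f = s⁺`, `g = s⁻` are Christoffel dual in the coordinates `(u,v)`, with constant
`C` and functions `U = U(u)`, `V = V(v)`:
`g_u = C U f_u / |f_u|²`, `g_v = - C V f_v / |f_v|²`, where `|f_u|² / U = |f_v|² / V`. -/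
structure AreChristoffelDual (D : Set (ℝ × ℝ)) (f g : ℝ × ℝ → R42) (C : ℝ) (U V : ℝ → ℝ) :
    Prop where
  ne_u : ∀ x ∈ D, ip (pd1 f x) (pd1 f x) ≠ 0 ∧ U x.1 ≠ 0
  ne_v : ∀ x ∈ D, ip (pd2 f x) (pd2 f x) ≠ 0 ∧ V x.2 ≠ 0
  eq_u : ∀ x ∈ D, pd1 g x = (C * U x.1 / ip (pd1 f x) (pd1 f x)) • pd1 f x
  eq_v : ∀ x ∈ D, pd2 g x = (-(C * V x.2) / ip (pd2 f x) (pd2 f x)) • pd2 f x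
  ratio : ∀ x ∈ D, ip (pd1 f x) (pd1 f x) / U x.1 = ip (pd2 f x) (pd2 f x) / V x.2

/-- The polynomial
`p_C(x) = κ₁ κ⁻ x² + (Δ² + 2 κ₁ ε C) x + κ₁ κ⁺ C²`. -/
def polyC (κ₁ κp κm ε Δ C : ℝ) : Polynomial ℝ :=
  Polynomial.C (κ₁ * κm) * Polynomial.X ^ 2
    + Polynomial.C (Δ ^ 2 + 2 * κ₁ * ε * C) * Polynomial.X
    + Polynomial.C (κ₁ * κp * C ^ 2)

end LieSphere

end

/-!
Because `p^⊥` contains no null plane, a sphere of a contact element of `Λ` that is perpendicular to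
both linear sphere complexes vanishes (`eq_zero_of_perp_spaceForm`). Hence `s⁺` and `s⁻` have unique
lifts `f`, `g` with `(f, p⁺) = (g, p⁻) = 0` and `(f, p⁻) = (g, p⁺) = Δ`, and by uniqueness these
lifts are rotated profile curves (`IsNormalizedPair.rotational`). The components of the curves along
`v₁, v₂, e₂` are `a = (r, x, y)` and `b = (R, X, Y)`, vectors with a constant Gram matrix of
determinant `Δ ^ 3`.

Derivatives of the normalized lifts are perpendicular to both complexes, so that the curvature
sphere conditions become equations between these derivatives rather than congruences modulo the
contact element. Harmonic separation and the immersion condition then give `r ≠ 0` and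
`b' = -(R / r) a'` (`exists_dualProfile`). The first component of the latter says that `C = r R` is
constant, and `f`, `g` are Christoffel dual with this constant. By the signature `a'` is spacelike,
so that there is a conformal parameter, with `|a'|² = r²` (`IsDualProfile.exists_conformal`).

The contact condition makes `a'` normal to `a` and `b`, hence a multiple of their cross product. Its
length fixes the multiple up to a sign, which is constant by continuity and becomes the orientation
`σ`; reading off the first component and the angular momentum of `a` gives the system for the
radius and the angle (`profile_equations`, `exists_polar_profile`). The squared derivative of the
radius is nonnegative, which makes the roots of `p_C` real when `κ⁻ < 0` (`exists_roots_polyC`).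
-/

noncomputable section

namespace LieSphere

/-! ### The inner product -/

lemma ip_comm (x y : R42) : ip x y = ip y x := by simp only [ip]; ring

lemma ip_add_left (x y z : R42) : ip (x + y) z = ip x z + ip y z := by
  simp only [ip, Pi.add_apply]; ring

lemma ip_smul_left (a : ℝ) (x z : R42) : ip (a • x) z = a * ip x z := by
  simp only [ip, Pi.smul_apply, smul_eq_mul]; ring

lemma ip_add_right (x y z : R42) : ip x (y + z) = ip x y + ip x z := by
  simp only [ip, Pi.add_apply]; ring

lemma ip_smul_right (a : ℝ) (x z : R42) : ip x (a • z) = a * ip x z := by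
  simp only [ip, Pi.smul_apply, smul_eq_mul]; ring

lemma ip_sub_left (x y z : R42) : ip (x - y) z = ip x z - ip y z := by
  simp only [ip, Pi.sub_apply]; ring

@[simp] lemma ip_zero_left (z : R42) : ip 0 z = 0 := by simp [ip]

/-- The inner product with a fixed vector as a continuous linear functional. -/
def ipL (z : R42) : R42 →L[ℝ] ℝ :=
  LinearMap.toContinuousLinearMap
    { toFun := fun x => ip x z
      map_add' := fun x y => ip_add_left x y z
      map_smul' := fun a x => ip_smul_left a x z }

@[simp] lemma ipL_apply (z x : R42) : ipL z x = ip x z := rfl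

/-- As the inner product has index two, the nonpositive vectors `a, b, c` of a pairwise orthogonal
triple are linearly dependent if at least two of them are lightlike. -/
lemma exists_relation_of_nonpos {a b c : R42} (haa : ip a a = 0) (hbb : ip b b = 0)
    (hcc : ip c c ≤ 0) (hab : ip a b = 0) (hac : ip a c = 0) (hbc : ip b c = 0) :
    ∃ u v w : ℝ, (u ≠ 0 ∨ v ≠ 0 ∨ w ≠ 0) ∧ u • a + v • b + w • c = 0 := by
  -- some nontrivial combination has vanishing timelike coordinates
  let T : (Fin 3 → ℝ) →ₗ[ℝ] (Fin 2 → ℝ) :=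
    Matrix.toLin' !![a 0, b 0, c 0; a 5, b 5, c 5]
  have hT : LinearMap.ker T ≠ ⊥ := LinearMap.ker_ne_bot_of_finrank_lt (by simp)
  obtain ⟨k, hk, hk0⟩ := (Submodule.ne_bot_iff _).1 hT
  have hk' : T k = 0 := hk
  have h0 := congrFun hk' 0
  have h5 := congrFun hk' 1
  simp [T, Matrix.toLin'_apply, Matrix.mulVec, dotProduct, Fin.sum_univ_three] at h0 h5
  refine ⟨k 0, k 1, k 2, ?_, ?_⟩
  · by_contra! h
    apply hk0
    ext i
    fin_cases i <;> simp [h.1, h.2.1, h.2.2]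
  set z := k 0 • a + k 1 • b + k 2 • c with hz
  have hz0 : z 0 = 0 := by simp [hz]; linarith
  have hz5 : z 5 = 0 := by simp [hz]; linarith
  have hzz : ip z z = k 2 ^ 2 * ip c c := by
    simp only [hz, ip_add_left, ip_add_right, ip_smul_left, ip_smul_right, ip_comm b a,
      ip_comm c a, ip_comm c b, haa, hbb, hab, hac, hbc]
    ring
  have hle : ip z z ≤ 0 := by
    rw [hzz]; exact mul_nonpos_of_nonneg_of_nonpos (sq_nonneg _) hcc
  simp only [ip, hz0, hz5] at hle
  have h1 : z 1 = 0 := by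
    nlinarith [sq_nonneg (z 1), sq_nonneg (z 2), sq_nonneg (z 3), sq_nonneg (z 4)]
  have h2 : z 2 = 0 := by
    nlinarith [sq_nonneg (z 1), sq_nonneg (z 2), sq_nonneg (z 3), sq_nonneg (z 4)]
  have h3 : z 3 = 0 := by
    nlinarith [sq_nonneg (z 1), sq_nonneg (z 2), sq_nonneg (z 3), sq_nonneg (z 4)]
  have h4 : z 4 = 0 := by
    nlinarith [sq_nonneg (z 1), sq_nonneg (z 2), sq_nonneg (z 3), sq_nonneg (z 4)]
  ext i
  fin_cases i <;> simp [hz0, h1, h2, h3, h4, hz5]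

/-- Six pairwise orthogonal vectors of nonzero norms are a basis, and the product of the norms is
positive since the index of the inner product is even. -/
lemma orthogonal_sextuple (b : Fin 6 → R42) (n : Fin 6 → ℝ) (hn : ∏ i, n i ≠ 0)
    (hb : ∀ i j, ip (b i) (b j) = if i = j then n i else 0) :
    0 < ∏ i, n i ∧ ∀ z, (∀ i, ip z (b i) = 0) → z = 0 := by
  let M : Matrix (Fin 6) (Fin 6) ℝ := Matrix.of b
  let s : Fin 6 → ℝ := ![-1, 1, 1, 1, 1, -1]
  have hM : M * Matrix.diagonal s * M.transpose = Matrix.diagonal n := by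
    ext i j
    rw [Matrix.diagonal_apply, ← hb i j, Matrix.mul_apply]
    simp only [Matrix.mul_diagonal, Matrix.transpose_apply, Fin.sum_univ_six, ip, M, s,
      Matrix.of_apply]
    simp
    ring
  have hdet : M.det ^ 2 = ∏ i, n i := by
    have := congrArg Matrix.det hM
    rw [Matrix.det_mul, Matrix.det_mul, Matrix.det_transpose, Matrix.det_diagonal,
      Matrix.det_diagonal] at this
    rw [← this]
    simp [s, Fin.prod_univ_six]
    ring
  have hM0 : M.det ≠ 0 := by
    intro h
    rw [h] at hdet
    exact hn (by rw [← hdet]; simp)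
  refine ⟨by rw [← hdet]; positivity, fun z hz => ?_⟩
  have h0 : M.mulVec (fun i => s i * z i) = 0 := by
    ext i
    have := hz i
    simp only [Matrix.mulVec, dotProduct, Fin.sum_univ_six, M, s, Matrix.of_apply, ip] at this ⊢
    simp
    linarith
  have h1 := Matrix.eq_zero_of_mulVec_eq_zero hM0 h0
  ext i
  have := congrFun h1 i
  fin_cases i <;> simpa [s] using this

/-! ### Rotations -/

lemma kcos_zero (κ : ℝ) : kcos κ 0 = 1 := by simp [kcos]

lemma ksin_zero (κ : ℝ) : ksin κ 0 = 0 := by simp [ksin]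

lemma kcos_sq_add {κ : ℝ} (hκ : κ = 1 ∨ κ = -1) (θ : ℝ) :
    kcos κ θ ^ 2 + κ * ksin κ θ ^ 2 = 1 := by
  rcases hκ with rfl | rfl
  · simp [kcos, ksin]
  · have h : ¬ (0 : ℝ) < -1 := by norm_num
    simp only [kcos, ksin, h, if_false, Real.cosh_sq]; ring

lemma hasDerivAt_kcos {κ : ℝ} (hκ : κ = 1 ∨ κ = -1) (θ : ℝ) :
    HasDerivAt (kcos κ) (-(κ * ksin κ θ)) θ := by
  rcases hκ with rfl | rfl
  · have : kcos 1 = Real.cos := by ext; simp [kcos]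
    rw [this]; simpa [ksin] using Real.hasDerivAt_cos θ
  · have h : ¬ (0 : ℝ) < -1 := by norm_num
    have : kcos (-1) = Real.cosh := by ext; simp [kcos, h]
    rw [this]; simpa [ksin, h] using Real.hasDerivAt_cosh θ

lemma hasDerivAt_ksin {κ : ℝ} (hκ : κ = 1 ∨ κ = -1) (θ : ℝ) :
    HasDerivAt (ksin κ) (kcos κ θ) θ := by
  rcases hκ with rfl | rfl
  · have : ksin 1 = Real.sin := by ext; simp [ksin]
    rw [this]; simpa [kcos] using Real.hasDerivAt_sin θ
  · have h : ¬ (0 : ℝ) < -1 := by norm_num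
    have : ksin (-1) = Real.sinh := by ext; simp [ksin, h]
    rw [this]; simpa [kcos, h] using Real.hasDerivAt_sinh θ

/-- The points of the unit circle or of the unit hyperbola are parametrized by the rotation angle,
up to sign: the sign distinguishes the branches of the hyperbola. -/
lemma exists_angle {κ : ℝ} (hκ : κ = 1 ∨ κ = -1) {u v : ℝ} (h : u ^ 2 + κ * v ^ 2 = 1) :
    ∃ s ψ : ℝ, (s = 1 ∨ s = -1) ∧ u = s * kcos κ ψ ∧ v = s * ksin κ ψ := by
  rcases hκ with rfl | rfl
  · refine ⟨1, Complex.arg ⟨u, v⟩, Or.inl rfl, ?_⟩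
    have hn : ‖(⟨u, v⟩ : ℂ)‖ = 1 := by
      rw [Complex.norm_eq_sqrt_sq_add_sq]
      simp only
      rw [show u ^ 2 + v ^ 2 = 1 by linarith, Real.sqrt_one]
    have hz : (⟨u, v⟩ : ℂ) ≠ 0 := by
      intro h0; rw [h0] at hn; simp at hn
    simp [kcos, ksin, Complex.cos_arg hz, Complex.sin_arg, hn]
  · have hneg : ¬ (0 : ℝ) < -1 := by norm_num
    simp only [kcos, ksin, hneg, if_false]
    rcases le_or_gt 0 u with hu | hu
    · refine ⟨1, Real.arsinh v, Or.inl rfl, ?_, by simp⟩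
      rw [Real.cosh_arsinh, one_mul, show 1 + v ^ 2 = u ^ 2 by linarith, Real.sqrt_sq hu]
    · refine ⟨-1, Real.arsinh (-v), Or.inr rfl, ?_, by simp⟩
      rw [Real.cosh_arsinh, show 1 + (-v) ^ 2 = (-u) ^ 2 by linarith, Real.sqrt_sq (by linarith)]
      ring

lemma rot_add (v e : R42) (κ θ : ℝ) (x y : R42) :
    rot v e κ θ (x + y) = rot v e κ θ x + rot v e κ θ y := by
  simp only [rot, planePart, ip_add_left]; module

lemma rot_smul (v e : R42) (κ θ : ℝ) (a : ℝ) (x : R42) :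
    rot v e κ θ (a • x) = a • rot v e κ θ x := by
  simp only [rot, planePart, ip_smul_left]; module

lemma rot_zero_angle (v e : R42) (κ : ℝ) (x : R42) : rot v e κ 0 x = x := by
  simp only [rot, planePart, kcos_zero, ksin_zero]; module

/-- Rotations are the identity on the orthogonal complement of the plane, so that they do not
change the inner product with vectors therein. -/
lemma ip_rot_of_perp {v e z : R42} (hv : ip v z = 0) (he : ip e z = 0) (κ θ : ℝ) (x : R42) :
    ip (rot v e κ θ x) z = ip x z := by
  simp only [rot, planePart, ip_add_left, ip_sub_left, ip_smul_left, hv, he]; ring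

lemma rot_of_ip_eq_zero {v e x : R42} (κ θ : ℝ) (hx : ip x e = 0) :
    rot v e κ θ x = x + (κ * ip x v) • ((kcos κ θ - 1) • v + ksin κ θ • e) := by
  simp only [rot, planePart, hx]; module

/-! ### Primitives, reparametrizations and polar coordinates -/

lemma hasDerivAt_of_contDiffOn {E : Type*} [NormedAddCommGroup E] [NormedSpace ℝ E] {I : Set ℝ}
    (hI : IsOpen I) {f : ℝ → E} (hf : ContDiffOn ℝ ∞ f I) {t : ℝ} (ht : t ∈ I) :
    HasDerivAt f (deriv f t) t :=
  (((hf t ht).contDiffAt (hI.mem_nhds ht)).differentiableAt (by simp)).hasDerivAt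

lemma contDiffOn_deriv {E : Type*} [NormedAddCommGroup E] [NormedSpace ℝ E] {I : Set ℝ}
    (hI : IsOpen I) {f : ℝ → E} (hf : ContDiffOn ℝ ∞ f I) : ContDiffOn ℝ ∞ (deriv f) I :=
  ((contDiffOn_infty_iff_deriv_of_isOpen hI).1 hf).2

lemma exists_primitive {I : Set ℝ} (hI : IsOpen I) (hIc : I.OrdConnected) (hIn : I.Nonempty)
    {h : ℝ → ℝ} (hh : ContDiffOn ℝ ∞ h I) (c : ℝ) :
    ∃ t₀ ∈ I, ∃ F : ℝ → ℝ, F t₀ = c ∧ ContDiffOn ℝ ∞ F I ∧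
      ∀ t ∈ I, HasDerivAt F (h t) t := by
  obtain ⟨t₀, ht₀⟩ := hIn
  have key : ∀ t ∈ I, HasDerivAt (fun t => c + ∫ u in t₀..t, h u) (h t) t := by
    intro t ht
    refine (intervalIntegral.integral_hasDerivAt_right ?_ ?_ ?_).const_add c
    · exact (hh.continuousOn.mono (hIc.uIcc_subset ht₀ ht)).intervalIntegrable
    · exact hh.continuousOn.stronglyMeasurableAtFilter hI t ht
    · exact hh.continuousOn.continuousAt (hI.mem_nhds ht)
  refine ⟨t₀, ht₀, _, by simp, ?_, key⟩
  rw [contDiffOn_infty_iff_deriv_of_isOpen hI]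
  exact ⟨fun t ht => (key t ht).differentiableAt.differentiableWithinAt,
    hh.congr fun t ht => (key t ht).deriv⟩

/-- The autonomous equation `φ' = h(φ)` with `h > 0` on an interval `I` has a solution that runs
through `I`: the inverse of a primitive of `1 / h`. -/
lemma exists_reparametrization {I : Set ℝ} (hI : IsOpen I) (hIc : I.OrdConnected)
    (hIn : I.Nonempty) {h : ℝ → ℝ} (hh : ContDiffOn ℝ ∞ h I) (hpos : ∀ t ∈ I, 0 < h t) :
    ∃ (J : Set ℝ) (φ : ℝ → ℝ), IsOpen J ∧ J.OrdConnected ∧ ContDiffOn ℝ ∞ φ J ∧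
      Set.BijOn φ J I ∧ ∀ τ ∈ J, HasDerivAt φ (h (φ τ)) τ := by
  obtain ⟨_, _, s, -, hs, hs'⟩ := exists_primitive hI hIc hIn
    (h := fun t => (h t)⁻¹) (hh.inv fun t ht => (hpos t ht).ne') 0
  have hmono : StrictMonoOn s I := by
    refine strictMonoOn_of_deriv_pos hIc.convex hs.continuousOn fun t ht => ?_
    rw [(hs' t (interior_subset ht)).deriv]
    exact inv_pos.2 (hpos t (interior_subset ht))
  set φ := Function.invFunOn s I with hφ
  have hinv : Set.InvOn φ s I (s '' I) :=
    ⟨hmono.injOn.leftInvOn_invFunOn, (Set.surjOn_image s I).rightInvOn_invFunOn⟩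
  have hmaps : Set.MapsTo φ (s '' I) I := (Set.surjOn_image s I).mapsTo_invFunOn
  -- near each point, `φ` agrees with the smooth inverse given by the inverse function theorem
  have loc : ∀ t ∈ I, s '' I ∈ nhds (s t) ∧ ContDiffAt ℝ ∞ φ (s t) := by
    intro t ht
    have hne : (h t)⁻¹ ≠ 0 := inv_ne_zero (hpos t ht).ne'
    have hc : ContDiffAt ℝ ∞ s t := (hs t ht).contDiffAt (hI.mem_nhds ht)
    have hstrict : HasStrictDerivAt s (h t)⁻¹ t := hc.hasStrictDerivAt' (hs' t ht) (by simp)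
    have hmem : s '' I ∈ nhds (s t) := by
      rw [← hstrict.map_nhds_eq hne]
      exact Filter.image_mem_map (hI.mem_nhds ht)
    refine ⟨hmem, ?_⟩
    have hf' := (hs' t ht).hasFDerivAt_equiv hne
    have hl := hc.to_localInverse hf' (by simp)
    refine hl.congr_of_eventuallyEq ?_
    have hl0 : hc.localInverse hf' (by simp) (s t) = t := hc.localInverse_apply_image hf' (by simp)
    have h1 : ∀ᶠ τ in nhds (s t), hc.localInverse hf' (by simp) τ ∈ I :=
      hl.continuousAt.eventually (by rw [hl0]; exact hI.mem_nhds ht)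
    have h2 : ∀ᶠ τ in nhds (s t), s (hc.localInverse hf' (by simp) τ) = τ :=
      (hc.hasStrictFDerivAt' hf' (by simp)).eventually_right_inverse
    filter_upwards [h1, h2] with τ hτ1 hτ2
    calc φ τ = φ (s (hc.localInverse hf' (by simp) τ)) := by rw [hτ2]
      _ = _ := hinv.1 hτ1
  have hJ : IsOpen (s '' I) := isOpen_iff_mem_nhds.2 (by
    rintro _ ⟨t, ht, rfl⟩; exact (loc t ht).1)
  have hφs : ContDiffOn ℝ ∞ φ (s '' I) := by
    rintro _ ⟨t, ht, rfl⟩; exact (loc t ht).2.contDiffWithinAt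
  refine ⟨s '' I, φ, hJ, ?_, hφs, hinv.symm.bijOn hmaps (Set.mapsTo_image s I), ?_⟩
  · exact (hIc.isPreconnected.image s hs.continuousOn).ordConnected
  · rintro τ hτ
    have hd := hasDerivAt_of_contDiffOn hJ hφs hτ
    have hc := (hs' (φ τ) (hmaps hτ)).comp τ hd
    have hid : HasDerivAt (s ∘ φ) 1 τ := (hasDerivAt_id τ).congr_of_eventuallyEq
      (by filter_upwards [hJ.mem_nhds hτ] with u hu using hinv.2 hu)
    have := hc.unique hid
    have hp := hpos _ (hmaps hτ)
    rw [show h (φ τ) = deriv φ τ by field_simp at this; linarith]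
    exact hd

/-- Polar coordinates along a curve on the circle or hyperbola `u² + κ v² = 1` that solves the
rotation equation with angular speed `h`: the angle is any primitive of `h` with the right
initial value, since rotating the curve back by it gives a constant. -/
lemma exists_angle_function {κ : ℝ} (hκ : κ = 1 ∨ κ = -1) {J : Set ℝ} (hJ : IsOpen J)
    (hJc : J.OrdConnected) (hJn : J.Nonempty) {u v h : ℝ → ℝ} (hh : ContDiffOn ℝ ∞ h J)
    (huv : ∀ t ∈ J, u t ^ 2 + κ * v t ^ 2 = 1)
    (hu : ∀ t ∈ J, HasDerivAt u (-(κ * v t * h t)) t) (hv : ∀ t ∈ J, HasDerivAt v (u t * h t) t) :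
    ∃ (s : ℝ) (ψ : ℝ → ℝ), (s = 1 ∨ s = -1) ∧ ContDiffOn ℝ ∞ ψ J ∧
      (∀ t ∈ J, HasDerivAt ψ (h t) t) ∧
      ∀ t ∈ J, u t = s * kcos κ (ψ t) ∧ v t = s * ksin κ (ψ t) := by
  obtain ⟨t₀, ht₀, ψ₁, -, hψs, hψ'⟩ := exists_primitive hJ hJc hJn hh 0
  obtain ⟨s, ψ₀, hs, hu0, hv0⟩ := exists_angle hκ (huv t₀ ht₀)
  let ψ : ℝ → ℝ := fun t => ψ₁ t + (ψ₀ - ψ₁ t₀)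
  have hd : ∀ t ∈ J, HasDerivAt ψ (h t) t := fun t ht => (hψ' t ht).add_const _
  have hc : ∀ t ∈ J, HasDerivAt (fun t => kcos κ (ψ t)) (-(κ * ksin κ (ψ t)) * h t) t :=
    fun t ht => (hasDerivAt_kcos hκ (ψ t)).comp t (hd t ht)
  have hsn : ∀ t ∈ J, HasDerivAt (fun t => ksin κ (ψ t)) (kcos κ (ψ t) * h t) t :=
    fun t ht => (hasDerivAt_ksin hκ (ψ t)).comp t (hd t ht)
  have h1 : ∀ t ∈ J, HasDerivAt (fun t => u t * kcos κ (ψ t) + κ * (v t * ksin κ (ψ t))) 0 t := by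
    intro t ht
    convert! ((hu t ht).mul (hc t ht)).add (((hv t ht).mul (hsn t ht)).const_mul κ) using 1
    ring
  have h2 : ∀ t ∈ J, HasDerivAt (fun t => v t * kcos κ (ψ t) - u t * ksin κ (ψ t)) 0 t := by
    intro t ht
    convert! ((hv t ht).mul (hc t ht)).sub ((hu t ht).mul (hsn t ht)) using 1
    ring
  have hψ0 : ψ t₀ = ψ₀ := by simp [ψ]
  refine ⟨s, ψ, hs, hψs.add contDiffOn_const, hd, fun t ht => ?_⟩
  have e1 := hJ.is_const_of_deriv_eq_zero hJc.isPreconnected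
    (fun t ht => (h1 t ht).differentiableAt.differentiableWithinAt)
    (fun t ht => (h1 t ht).deriv) ht ht₀
  have e2 := hJ.is_const_of_deriv_eq_zero hJc.isPreconnected
    (fun t ht => (h2 t ht).differentiableAt.differentiableWithinAt)
    (fun t ht => (h2 t ht).deriv) ht ht₀
  simp only [hψ0, hu0, hv0] at e1 e2
  have p0 := kcos_sq_add hκ ψ₀
  have p := kcos_sq_add hκ (ψ t)
  have e1' : u t * kcos κ (ψ t) + κ * (v t * ksin κ (ψ t)) = s := by
    rw [e1]; linear_combination s * p0
  have e2' : v t * kcos κ (ψ t) - u t * ksin κ (ψ t) = 0 := by rw [e2]; ring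
  constructor
  · linear_combination (-u t) * p + kcos κ (ψ t) * e1' - κ * ksin κ (ψ t) * e2'
  · linear_combination (-v t) * p + ksin κ (ψ t) * e1' + kcos κ (ψ t) * e2'

/-- Polar coordinates `x = d cos ψ`, `y = σ d sin ψ` (or their hyperbolic analogues) along a curve
in a plane of signature `(κ, 1)` that has the causal character of the first axis. -/
lemma exists_polar {κ : ℝ} (hκ : κ = 1 ∨ κ = -1) {J : Set ℝ} (hJ : IsOpen J)
    (hJc : J.OrdConnected) (hJn : J.Nonempty) {x y h : ℝ → ℝ} {σ : ℝ} (hσ : σ = 1 ∨ σ = -1)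
    (hx : ContDiffOn ℝ ∞ x J) (hy : ContDiffOn ℝ ∞ y J) (hh : ContDiffOn ℝ ∞ h J)
    (hpos : ∀ t ∈ J, 0 < x t ^ 2 + κ * y t ^ 2)
    (hang : ∀ t ∈ J, h t * (x t ^ 2 + κ * y t ^ 2) = σ * (x t * deriv y t - y t * deriv x t)) :
    ∃ ψ d : ℝ → ℝ, ContDiffOn ℝ ∞ ψ J ∧ ContDiffOn ℝ ∞ d J ∧
      (∀ t ∈ J, HasDerivAt ψ (h t) t) ∧ ∀ t ∈ J, d t ^ 2 = x t ^ 2 + κ * y t ^ 2 ∧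
      x t = d t * kcos κ (ψ t) ∧ y t = σ * (d t * ksin κ (ψ t)) := by
  have hσ2 : σ ^ 2 = 1 := by rcases hσ with rfl | rfl <;> norm_num
  set D : ℝ → ℝ := fun t => Real.sqrt (x t ^ 2 + κ * y t ^ 2) with hD
  have hDs : ContDiffOn ℝ ∞ D J :=
    ((hx.pow 2).add (contDiffOn_const.mul (hy.pow 2))).sqrt fun t ht => (hpos t ht).ne'
  have hD0 : ∀ t ∈ J, D t ≠ 0 := fun t ht => (Real.sqrt_pos.2 (hpos t ht)).ne'
  have hDsq : ∀ t ∈ J, D t ^ 2 = x t ^ 2 + κ * y t ^ 2 := fun t ht =>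
    Real.sq_sqrt (hpos t ht).le
  set u : ℝ → ℝ := fun t => x t / D t with hu
  set v : ℝ → ℝ := fun t => σ * y t / D t with hv
  have hus : ContDiffOn ℝ ∞ u J := hx.div hDs hD0
  have hvs : ContDiffOn ℝ ∞ v J := (contDiffOn_const.mul hy).div hDs hD0
  have hxu : ∀ t ∈ J, x t = u t * D t := fun t ht => by
    have := hD0 t ht; simp only [hu]; field_simp
  have hyv : ∀ t ∈ J, y t = σ * (v t * D t) := fun t ht => by
    have := hD0 t ht; simp only [hv]; field_simp; linear_combination -y t * hσ2
  have huv : ∀ t ∈ J, u t ^ 2 + κ * v t ^ 2 = 1 := by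
    intro t ht
    have h1 := hDsq t ht
    rw [hxu t ht, hyv t ht] at h1
    have h2 : D t ^ 2 ≠ 0 := pow_ne_zero 2 (hD0 t ht)
    apply mul_right_cancel₀ h2
    linear_combination -h1 - κ * v t ^ 2 * D t ^ 2 * hσ2
  have hder : ∀ t ∈ J, deriv u t = -(κ * v t * h t) ∧ deriv v t = u t * h t := by
    intro t ht
    have du := hasDerivAt_of_contDiffOn hJ hus ht
    have dv := hasDerivAt_of_contDiffOn hJ hvs ht
    have dD := hasDerivAt_of_contDiffOn hJ hDs ht
    have dx := (du.mul dD).congr_of_eventuallyEq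
      (by filter_upwards [hJ.mem_nhds ht] with w hw using hxu w hw)
    have dy := ((dv.mul dD).const_mul σ).congr_of_eventuallyEq
      (by filter_upwards [hJ.mem_nhds ht] with w hw using hyv w hw)
    have c0 := (((du.pow 2).add ((dv.pow 2).const_mul κ)).congr_of_eventuallyEq
      (f₁ := fun _ => (1 : ℝ))
      (by filter_upwards [hJ.mem_nhds ht] with w hw using (huv w hw).symm)).unique
        (hasDerivAt_const t (1 : ℝ))
    simp only [Nat.cast_ofNat, Nat.add_one_sub_one, pow_one] at c0
    have a0 := hang t ht
    rw [dx.deriv, dy.deriv, ← hDsq t ht, hxu t ht, hyv t ht] at a0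
    have a1 : h t = u t * deriv v t - v t * deriv u t := by
      have h2 : D t ^ 2 ≠ 0 := pow_ne_zero 2 (hD0 t ht)
      apply mul_right_cancel₀ h2
      linear_combination a0 + (u t * deriv v t - v t * deriv u t) * D t ^ 2 * hσ2
    have p := huv t ht
    constructor
    · linear_combination (-deriv u t) * p + u t / 2 * c0 + κ * v t * a1
    · linear_combination (-deriv v t) * p + v t / 2 * c0 - u t * a1
  obtain ⟨s, ψ, hs, hψ, hψ', hangle⟩ := exists_angle_function hκ hJ hJc hJn hh huv
    (fun t ht => by rw [← (hder t ht).1]; exact hasDerivAt_of_contDiffOn hJ hus ht)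
    (fun t ht => by rw [← (hder t ht).2]; exact hasDerivAt_of_contDiffOn hJ hvs ht)
  refine ⟨ψ, fun t => s * D t, hψ, contDiffOn_const.mul hDs, hψ', fun t ht => ⟨?_, ?_, ?_⟩⟩
  · have hs2 : s ^ 2 = 1 := by rcases hs with rfl | rfl <;> norm_num
    rw [mul_pow, hs2, hDsq t ht, one_mul]
  · rw [hxu t ht, (hangle t ht).1]; ring
  · rw [hyv t ht, (hangle t ht).2]; ring

/-! ### The profile curve -/

/-- The normals of a plane in three-space with the metric `diag(κ₁, κ₂, 1)` are the multiples of
the cross product of a pair of spanning vectors; the factor is found from the length of the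
normal. Here `(r, x, y)`, `(R, X, Y)` span the plane, with Gram determinant `Δ ^ 3`. -/
lemma normal_eq_cross {κ₁ κ₂ κp κm ε Δ r x y R X Y dr dx dy : ℝ}
    (hκ₁ : κ₁ = 1 ∨ κ₁ = -1) (hκ₂ : κ₂ = 1 ∨ κ₂ = -1) (hΔ : Δ = κp * κm - ε ^ 2) (hΔ0 : Δ ≠ 0)
    (haa : κ₁ * r ^ 2 + κ₂ * x ^ 2 + y ^ 2 = -(κp * Δ))
    (hbb : κ₁ * R ^ 2 + κ₂ * X ^ 2 + Y ^ 2 = -(κm * Δ))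
    (hab : κ₁ * r * R + κ₂ * x * X + y * Y = ε * Δ)
    (hda : κ₁ * r * dr + κ₂ * x * dx + y * dy = 0)
    (hdb : κ₁ * R * dr + κ₂ * X * dx + Y * dy = 0) :
    ∃ l : ℝ, l = (dr * (x * Y - y * X) + dx * (y * R - r * Y) + dy * (r * X - x * R))
        / (κ₁ * κ₂ * Δ ^ 3) ∧
      dr = l * (κ₁ * (x * Y - y * X)) ∧ dx = l * (κ₂ * (y * R - r * Y)) ∧
      dy = l * (r * X - x * R) := by
  have h1 : κ₁ ^ 2 = 1 := by rcases hκ₁ with rfl | rfl <;> norm_num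
  have h2 : κ₂ ^ 2 = 1 := by rcases hκ₂ with rfl | rfl <;> norm_num
  have hne : κ₁ * κ₂ * Δ ^ 3 ≠ 0 := by
    refine mul_ne_zero (mul_ne_zero ?_ ?_) (pow_ne_zero 3 hΔ0)
    · rintro rfl; norm_num at h1
    · rintro rfl; norm_num at h2
  have hgram : (κ₁ * r ^ 2 + κ₂ * x ^ 2 + y ^ 2) * (κ₁ * R ^ 2 + κ₂ * X ^ 2 + Y ^ 2)
      - (κ₁ * r * R + κ₂ * x * X + y * Y) ^ 2 = Δ ^ 3 := by
    rw [haa, hbb, hab, hΔ]; ring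
  set S := dr * (x * Y - y * X) + dx * (y * R - r * Y) + dy * (r * X - x * R) with hS
  -- the expansion of a vector with respect to `a`, `b` and their cross product
  have kr : dr * Δ ^ 3 = κ₁ * κ₂ * S * (κ₁ * (x * Y - y * X)) := by
    have key : dr * ((κ₁ * r ^ 2 + κ₂ * x ^ 2 + y ^ 2) * (κ₁ * R ^ 2 + κ₂ * X ^ 2 + Y ^ 2)
        - (κ₁ * r * R + κ₂ * x * X + y * Y) ^ 2)
        = (r * (κ₁ * R ^ 2 + κ₂ * X ^ 2 + Y ^ 2) - R * (κ₁ * r * R + κ₂ * x * X + y * Y))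
          * (κ₁ * r * dr + κ₂ * x * dx + y * dy)
        + (R * (κ₁ * r ^ 2 + κ₂ * x ^ 2 + y ^ 2) - r * (κ₁ * r * R + κ₂ * x * X + y * Y))
          * (κ₁ * R * dr + κ₂ * X * dx + Y * dy)
        + κ₁ * κ₂ * S * (κ₁ * (x * Y - y * X)) := by
      rw [hS]
      rcases hκ₁ with rfl | rfl <;> rcases hκ₂ with rfl | rfl <;> ring
    rw [hgram, hda, hdb] at key
    linear_combination key
  have kx : dx * Δ ^ 3 = κ₁ * κ₂ * S * (κ₂ * (y * R - r * Y)) := by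
    have key : dx * ((κ₁ * r ^ 2 + κ₂ * x ^ 2 + y ^ 2) * (κ₁ * R ^ 2 + κ₂ * X ^ 2 + Y ^ 2)
        - (κ₁ * r * R + κ₂ * x * X + y * Y) ^ 2)
        = (x * (κ₁ * R ^ 2 + κ₂ * X ^ 2 + Y ^ 2) - X * (κ₁ * r * R + κ₂ * x * X + y * Y))
          * (κ₁ * r * dr + κ₂ * x * dx + y * dy)
        + (X * (κ₁ * r ^ 2 + κ₂ * x ^ 2 + y ^ 2) - x * (κ₁ * r * R + κ₂ * x * X + y * Y))
          * (κ₁ * R * dr + κ₂ * X * dx + Y * dy)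
        + κ₁ * κ₂ * S * (κ₂ * (y * R - r * Y)) := by
      rw [hS]
      rcases hκ₁ with rfl | rfl <;> rcases hκ₂ with rfl | rfl <;> ring
    rw [hgram, hda, hdb] at key
    linear_combination key
  have ky : dy * Δ ^ 3 = κ₁ * κ₂ * S * (r * X - x * R) := by
    have key : dy * ((κ₁ * r ^ 2 + κ₂ * x ^ 2 + y ^ 2) * (κ₁ * R ^ 2 + κ₂ * X ^ 2 + Y ^ 2)
        - (κ₁ * r * R + κ₂ * x * X + y * Y) ^ 2)
        = (y * (κ₁ * R ^ 2 + κ₂ * X ^ 2 + Y ^ 2) - Y * (κ₁ * r * R + κ₂ * x * X + y * Y))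
          * (κ₁ * r * dr + κ₂ * x * dx + y * dy)
        + (Y * (κ₁ * r ^ 2 + κ₂ * x ^ 2 + y ^ 2) - y * (κ₁ * r * R + κ₂ * x * X + y * Y))
          * (κ₁ * R * dr + κ₂ * X * dx + Y * dy)
        + κ₁ * κ₂ * S * (r * X - x * R) := by
      rw [hS]
      rcases hκ₁ with rfl | rfl <;> rcases hκ₂ with rfl | rfl <;> ring
    rw [hgram, hda, hdb] at key
    linear_combination key
  have h12 : κ₁ * κ₂ * (κ₁ * κ₂) = 1 := by linear_combination κ₂ ^ 2 * h1 + h2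
  refine ⟨_, rfl, ?_, ?_, ?_⟩
  all_goals
    rw [div_mul_eq_mul_div, eq_div_iff hne]
  · linear_combination κ₁ * κ₂ * kr + S * (κ₁ * (x * Y - y * X)) * h12
  · linear_combination κ₁ * κ₂ * kx + S * (κ₂ * (y * R - r * Y)) * h12
  · linear_combination κ₁ * κ₂ * ky + S * (r * X - x * R) * h12

/-- The radius and the angular speed of the profile curve, up to a factor `m` that is the same at
all points up to sign. -/
lemma profile_equations {κ₁ κ₂ κp κm ε Δ C r x y R X Y dr dx dy : ℝ}
    (hκ₁ : κ₁ = 1 ∨ κ₁ = -1) (hκ₂ : κ₂ = 1 ∨ κ₂ = -1) (hΔ : Δ = κp * κm - ε ^ 2) (hΔ0 : Δ ≠ 0)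
    (haa : κ₁ * r ^ 2 + κ₂ * x ^ 2 + y ^ 2 = -(κp * Δ))
    (hbb : κ₁ * R ^ 2 + κ₂ * X ^ 2 + Y ^ 2 = -(κm * Δ))
    (hab : κ₁ * r * R + κ₂ * x * X + y * Y = ε * Δ)
    (hda : κ₁ * r * dr + κ₂ * x * dx + y * dy = 0)
    (hdb : κ₁ * R * dr + κ₂ * X * dx + Y * dy = 0)
    (hC : r * R = C) (hr : r ≠ 0) (hunit : κ₁ * dr ^ 2 + κ₂ * dx ^ 2 + dy ^ 2 = r ^ 2) :
    ∃ m : ℝ, m = Δ / r * ((dr * (x * Y - y * X) + dx * (y * R - r * Y) + dy * (r * X - x * R))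
        / (κ₁ * κ₂ * Δ ^ 3)) ∧
      m ^ 2 = κ₁ * κ₂ / Δ ∧ x * dy - y * dx = κ₂ * m * (ε * r ^ 2 + κp * C) ∧
      dr ^ 2 = (κm * (r ^ 2) ^ 2 + (κ₁ * Δ ^ 2 + 2 * ε * C) * r ^ 2 + κp * C ^ 2) / Δ ^ 2 := by
  have h1 : κ₁ ^ 2 = 1 := by rcases hκ₁ with rfl | rfl <;> norm_num
  have h2 : κ₂ ^ 2 = 1 := by rcases hκ₂ with rfl | rfl <;> norm_num
  have hgram : (κ₁ * r ^ 2 + κ₂ * x ^ 2 + y ^ 2) * (κ₁ * R ^ 2 + κ₂ * X ^ 2 + Y ^ 2)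
      - (κ₁ * r * R + κ₂ * x * X + y * Y) ^ 2 = Δ ^ 3 := by
    rw [haa, hbb, hab, hΔ]; ring
  obtain ⟨l, hl, hlr, hlx, hly⟩ := normal_eq_cross hκ₁ hκ₂ hΔ hΔ0 haa hbb hab hda hdb
  have hll : l ^ 2 * (κ₁ * κ₂ * Δ ^ 3) = r ^ 2 := by
    rw [← hunit, ← hgram, hlr, hlx, hly]
    rcases hκ₁ with rfl | rfl <;> rcases hκ₂ with rfl | rfl <;> ring
  have h12 : κ₁ * κ₂ * (κ₁ * κ₂) = 1 := by linear_combination κ₂ ^ 2 * h1 + h2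
  have hm2 : (Δ / r * l) ^ 2 = κ₁ * κ₂ / Δ := by
    field_simp
    linear_combination κ₁ * κ₂ * hll - l ^ 2 * Δ ^ 3 * h12
  refine ⟨Δ / r * l, by rw [hl], hm2, ?_, ?_⟩
  · -- the double cross product formula
    have hw : x * dy - y * dx = l * κ₂ * (r * (κ₂ * x * X + y * Y) - R * (κ₂ * x ^ 2 + y ^ 2)) := by
      rw [hlx, hly]; linear_combination l * (x * x * R - r * x * X) * h2
    rw [hw, show κ₂ * x * X + y * Y = ε * Δ - κ₁ * r * R by linarith,
      show κ₂ * x ^ 2 + y ^ 2 = -(κp * Δ) - κ₁ * r ^ 2 by linarith, ← hC]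
    field_simp
    ring
  · have hD2 : Δ ^ 2 ≠ 0 := pow_ne_zero 2 hΔ0
    have hcross : κ₂ * (x * Y - y * X) ^ 2 = (κ₂ * x ^ 2 + y ^ 2) * (κ₂ * X ^ 2 + Y ^ 2)
        - (κ₂ * x * X + y * Y) ^ 2 := by ring
    rw [show κ₂ * x * X + y * Y = ε * Δ - κ₁ * r * R by linarith,
      show κ₂ * x ^ 2 + y ^ 2 = -(κp * Δ) - κ₁ * r ^ 2 by linarith,
      show κ₂ * X ^ 2 + Y ^ 2 = -(κm * Δ) - κ₁ * R ^ 2 by linarith] at hcross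
    have hs : (x * Y - y * X) ^ 2 * r ^ 2 = κ₂ * Δ * (κm * κ₁ * (r ^ 2) ^ 2
        + (Δ ^ 2 + 2 * κ₁ * ε * C) * r ^ 2 + κ₁ * κp * C ^ 2) := by
      rw [← hC]
      linear_combination κ₂ * r ^ 2 * hcross - (x * Y - y * X) ^ 2 * r ^ 2 * h2
        - κ₂ * Δ * r ^ 2 * Δ * hΔ
    rw [hlr, eq_div_iff hD2]
    rw [show (l * (κ₁ * (x * Y - y * X))) ^ 2 * Δ ^ 2
      = l ^ 2 * Δ ^ 2 * (x * Y - y * X) ^ 2 by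
        linear_combination l ^ 2 * Δ ^ 2 * (x * Y - y * X) ^ 2 * h1]
    have hr2 : r ^ 2 ≠ 0 := pow_ne_zero 2 hr
    apply mul_right_cancel₀ (mul_ne_zero hr2 hΔ0)
    rw [show l ^ 2 * Δ ^ 2 * (x * Y - y * X) ^ 2 * (r ^ 2 * Δ)
      = l ^ 2 * Δ ^ 3 * ((x * Y - y * X) ^ 2 * r ^ 2) by ring, hs]
    linear_combination (κ₁ * Δ * (κm * κ₁ * (r ^ 2) ^ 2
        + (Δ ^ 2 + 2 * κ₁ * ε * C) * r ^ 2 + κ₁ * κp * C ^ 2)) * hll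
      + (-l ^ 2 * Δ ^ 4 * κ₂ * κ₁ * (κm * r ^ 4 + 2 * r ^ 2 * ε * C + C ^ 2 * κp)
        - l ^ 2 * Δ ^ 6 * κ₂ * r ^ 2 + Δ * κm * r ^ 6 + Δ * r ^ 2 * C ^ 2 * κp
        + 2 * Δ * r ^ 4 * ε * C) * h1

/-- The system for a unit speed profile curve in polar coordinates. The curve `(r, x, y)` and its
dual `(R, X, Y)` are the components of the two lifts perpendicular to the linear sphere complexes;
the tangent of the curve is normal to both. -/
lemma exists_polar_profile {κ₁ κ₂ κp κm ε Δ C : ℝ}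
    (hκ₁ : κ₁ = 1 ∨ κ₁ = -1) (hκ₂ : κ₂ = 1 ∨ κ₂ = -1) (hΔ : Δ = κp * κm - ε ^ 2)
    (hsign : 0 < κ₁ * κ₂ / Δ) {J : Set ℝ} (hJ : IsOpen J) (hJc : J.OrdConnected)
    (hJn : J.Nonempty) {r x y R X Y : ℝ → ℝ} (hrs : ContDiffOn ℝ ∞ r J)
    (hxs : ContDiffOn ℝ ∞ x J) (hys : ContDiffOn ℝ ∞ y J) (hRs : ContDiffOn ℝ ∞ R J)
    (hXs : ContDiffOn ℝ ∞ X J) (hYs : ContDiffOn ℝ ∞ Y J)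
    (haa : ∀ t ∈ J, κ₁ * r t ^ 2 + κ₂ * x t ^ 2 + y t ^ 2 = -(κp * Δ))
    (hbb : ∀ t ∈ J, κ₁ * R t ^ 2 + κ₂ * X t ^ 2 + Y t ^ 2 = -(κm * Δ))
    (hab : ∀ t ∈ J, κ₁ * r t * R t + κ₂ * x t * X t + y t * Y t = ε * Δ)
    (hda : ∀ t ∈ J, κ₁ * r t * deriv r t + κ₂ * x t * deriv x t + y t * deriv y t = 0)
    (hdb : ∀ t ∈ J, κ₁ * R t * deriv r t + κ₂ * X t * deriv x t + Y t * deriv y t = 0)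
    (hC : ∀ t ∈ J, r t * R t = C) (hr : ∀ t ∈ J, r t ≠ 0)
    (hunit : ∀ t ∈ J, κ₁ * deriv r t ^ 2 + κ₂ * deriv x t ^ 2 + deriv y t ^ 2 = r t ^ 2)
    (hpos : ∀ t ∈ J, 0 < κ₂ * (κ₂ * x t ^ 2 + y t ^ 2)) :
    ∃ (σ : ℝ) (ψ d : ℝ → ℝ), (σ = 1 ∨ σ = -1) ∧ ContDiffOn ℝ ∞ ψ J ∧ ContDiffOn ℝ ∞ d J ∧
      ∀ t ∈ J, x t = d t * kcos κ₂ (ψ t) ∧ y t = σ * (d t * ksin κ₂ (ψ t)) ∧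
        κp * Δ + κ₁ * r t ^ 2 ≠ 0 ∧
        deriv ψ t = Real.sqrt (κ₁ * κ₂ / Δ)
          * ((ε * r t ^ 2 + κp * C) / (κp * Δ + κ₁ * r t ^ 2)) ∧
        d t ^ 2 = -((κp * Δ + κ₁ * r t ^ 2) / κ₂) ∧
        deriv r t ^ 2
          = (κm * (r t ^ 2) ^ 2 + (κ₁ * Δ ^ 2 + 2 * ε * C) * r t ^ 2 + κp * C ^ 2) / Δ ^ 2 := by
  have hΔ0 : Δ ≠ 0 := by rintro rfl; simp at hsign
  have h2 : κ₂ ^ 2 = 1 := by rcases hκ₂ with rfl | rfl <;> norm_num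
  have hκ₂0 : κ₂ ≠ 0 := by rintro rfl; norm_num at h2
  have hne : ∀ t ∈ J, κp * Δ + κ₁ * r t ^ 2 ≠ 0 := by
    intro t ht h0
    have h := hpos t ht
    rw [show κ₂ * x t ^ 2 + y t ^ 2 = 0 by linarith [haa t ht]] at h
    simp at h
  have hprof := fun t ht => profile_equations hκ₁ hκ₂ hΔ hΔ0 (haa t ht) (hbb t ht) (hab t ht)
    (hda t ht) (hdb t ht) (hC t ht) (hr t ht) (hunit t ht)
  set m : ℝ → ℝ := fun t => Δ / r t * ((deriv r t * (x t * Y t - y t * X t)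
    + deriv x t * (y t * R t - r t * Y t) + deriv y t * (r t * X t - x t * R t))
      / (κ₁ * κ₂ * Δ ^ 3)) with hm
  have hmc : ContinuousOn m J := by
    have cr := (contDiffOn_deriv hJ hrs).continuousOn
    have cx := (contDiffOn_deriv hJ hxs).continuousOn
    have cy := (contDiffOn_deriv hJ hys).continuousOn
    have c1 := hrs.continuousOn
    have c2 := hxs.continuousOn
    have c3 := hys.continuousOn
    have c4 := hRs.continuousOn
    have c5 := hXs.continuousOn
    have c6 := hYs.continuousOn
    exact (continuousOn_const.div c1 hr).mul
      ((((cr.mul ((c2.mul c6).sub (c3.mul c5))).add (cx.mul ((c3.mul c4).sub (c1.mul c6)))).add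
        (cy.mul ((c1.mul c5).sub (c2.mul c4)))).div_const _)
  set q := Real.sqrt (κ₁ * κ₂ / Δ) with hq
  have hq0 : q ≠ 0 := (Real.sqrt_pos.2 hsign).ne'
  -- the factor has constant square, hence is constant on the interval: its sign is `-σ`
  have hsgn : ∃ σ : ℝ, (σ = 1 ∨ σ = -1) ∧ ∀ t ∈ J, σ * m t = -q := by
    have hsq : Set.EqOn (m ^ 2) ((fun _ => q) ^ 2) J := by
      intro t ht
      obtain ⟨m', hm', h, -⟩ := hprof t ht
      simp only [Pi.pow_apply]
      rw [show m t = m' from hm'.symm, h, hq, Real.sq_sqrt hsign.le]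
    rcases hJc.isPreconnected.eq_or_eq_neg_of_sq_eq hmc continuousOn_const hsq (fun _ => hq0)
      with h | h
    · exact ⟨-1, Or.inr rfl, fun t ht => by rw [h ht]; ring⟩
    · exact ⟨1, Or.inl rfl, fun t ht => by rw [h ht]; simp⟩
  obtain ⟨σ, hσ, hσm⟩ := hsgn
  have hd2 : ∀ t ∈ J, x t ^ 2 + κ₂ * y t ^ 2 = -((κp * Δ + κ₁ * r t ^ 2) / κ₂) := by
    intro t ht
    field_simp
    linear_combination haa t ht + y t ^ 2 * h2
  obtain ⟨ψ, d, hψ, hd, hψ', hpol⟩ := exists_polar (κ := κ₂) (x := x) (y := y)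
    (h := fun t => q * ((ε * r t ^ 2 + κp * C) / (κp * Δ + κ₁ * r t ^ 2)))
    hκ₂ hJ hJc hJn hσ hxs hys
    (contDiffOn_const.mul (((contDiffOn_const.mul (hrs.pow 2)).add contDiffOn_const).div
      (contDiffOn_const.add (contDiffOn_const.mul (hrs.pow 2))) hne))
    (fun t ht => by
      have h := hpos t ht
      have e : x t ^ 2 + κ₂ * y t ^ 2 = κ₂ * (κ₂ * x t ^ 2 + y t ^ 2) := by
        linear_combination (-x t ^ 2) * h2
      rwa [e])
    (fun t ht => by
      obtain ⟨m', hm', -, h, -⟩ := hprof t ht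
      rw [h, hd2 t ht, ← show m t = m' from hm'.symm]
      have h1 := hne t ht
      have h3 := hσm t ht
      have e : q * ((ε * r t ^ 2 + κp * C) / (κp * Δ + κ₁ * r t ^ 2))
          * -((κp * Δ + κ₁ * r t ^ 2) / κ₂) = -(κ₂ * (q * (ε * r t ^ 2 + κp * C))) := by
        have e₀ : κ₂⁻¹ = κ₂ := inv_eq_of_mul_eq_one_left (by linear_combination h2)
        generalize κp * Δ + κ₁ * r t ^ 2 = W at h1 ⊢
        rw [div_eq_mul_inv W, e₀]
        field_simp
      rw [e]
      linear_combination (-(κ₂ * (ε * r t ^ 2 + κp * C))) * h3)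
  refine ⟨σ, ψ, d, hσ, hψ, hd, fun t ht => ⟨(hpol t ht).2.1, (hpol t ht).2.2, hne t ht,
    (hψ' t ht).deriv, ?_, ?_⟩⟩
  · rw [(hpol t ht).1, hd2 t ht]
  · obtain ⟨_, -, -, -, h⟩ := hprof t ht
    exact h

/-! ### Roots of a real quadratic polynomial -/

lemma aroots_quadratic {a b c : ℝ} (ha : a ≠ 0) :
    ∃ C₁ C₂ : ℂ, (Polynomial.C a * Polynomial.X ^ 2 + Polynomial.C b * Polynomial.X
        + Polynomial.C c : Polynomial ℝ).aroots ℂ = {C₁, C₂} ∧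
      (0 ≤ b ^ 2 - 4 * a * c → C₁.im = 0 ∧ C₂.im = 0) ∧
      ∀ z : ℂ, (a : ℂ) * z ^ 2 + b * z + c = a * (z - C₁) * (z - C₂) := by
  have hac : (a : ℂ) ≠ 0 := by exact_mod_cast ha
  obtain ⟨s, hs, him⟩ : ∃ s : ℂ, s ^ 2 = ((b ^ 2 - 4 * a * c : ℝ) : ℂ) ∧
      (0 ≤ b ^ 2 - 4 * a * c → ∃ x : ℝ, s = x) := by
    by_cases h : 0 ≤ b ^ 2 - 4 * a * c
    · exact ⟨(Real.sqrt (b ^ 2 - 4 * a * c) : ℝ), by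
        rw [← Complex.ofReal_pow, Real.sq_sqrt h], fun _ => ⟨_, rfl⟩⟩
    · obtain ⟨s, hs⟩ := IsAlgClosed.exists_pow_nat_eq ((b ^ 2 - 4 * a * c : ℝ) : ℂ) two_pos
      exact ⟨s, hs, fun h' => absurd h' h⟩
  push_cast at hs
  have hfac : ∀ z : ℂ, (a : ℂ) * z ^ 2 + b * z + c
      = a * (z - (-b + s) / (2 * a)) * (z - (-b - s) / (2 * a)) := by
    intro z
    field_simp
    linear_combination hs
  refine ⟨(-b + s) / (2 * a), (-b - s) / (2 * a), ?_, ?_, hfac⟩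
  · have hpoly : (Polynomial.C a * Polynomial.X ^ 2 + Polynomial.C b * Polynomial.X
        + Polynomial.C c : Polynomial ℝ).map (algebraMap ℝ ℂ)
        = Polynomial.C (a : ℂ) * ((Polynomial.X - Polynomial.C ((-b + s) / (2 * a)))
          * (Polynomial.X - Polynomial.C ((-b - s) / (2 * a)))) := by
      refine Polynomial.funext fun z => ?_
      simp only [Polynomial.map_add, Polynomial.map_mul, Polynomial.map_pow, Polynomial.map_C,
        Polynomial.map_X, Polynomial.eval_add, Polynomial.eval_mul, Polynomial.eval_pow,
        Polynomial.eval_C, Polynomial.eval_X, Polynomial.eval_sub, Complex.coe_algebraMap]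
      rw [hfac z, mul_assoc]
    rw [Polynomial.aroots_def, hpoly, Polynomial.roots_C_mul _ hac, Polynomial.roots_mul,
      Polynomial.roots_X_sub_C, Polynomial.roots_X_sub_C]
    · rfl
    · exact mul_ne_zero (Polynomial.X_sub_C_ne_zero _) (Polynomial.X_sub_C_ne_zero _)
  · intro h
    obtain ⟨x, rfl⟩ := him h
    constructor
    · rw [show (-(b : ℂ) + x) / (2 * a) = (((-b + x) / (2 * a) : ℝ) : ℂ) by push_cast; ring]
      exact Complex.ofReal_im _
    · rw [show (-(b : ℂ) - x) / (2 * a) = (((-b - x) / (2 * a) : ℝ) : ℂ) by push_cast; ring]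
      exact Complex.ofReal_im _

/-- The roots of `p_C` and the equation for the radius. If `κ⁻ < 0` the discriminant is nonnegative
because the square of the derivative of the radius is. -/
lemma exists_roots_polyC {κ₁ κp κm ε Δ C : ℝ} (hκ₁ : κ₁ = 1 ∨ κ₁ = -1) (hκm : κm ≠ 0)
    (hΔ0 : Δ ≠ 0) {J : Set ℝ} (hJn : J.Nonempty) {r : ℝ → ℝ}
    (hr : ∀ t ∈ J, deriv r t ^ 2
      = (κm * (r t ^ 2) ^ 2 + (κ₁ * Δ ^ 2 + 2 * ε * C) * r t ^ 2 + κp * C ^ 2) / Δ ^ 2) :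
    ∃ C₁ C₂ : ℂ, (polyC κ₁ κp κm ε Δ C).aroots ℂ = {C₁, C₂} ∧
      (¬ (0 < κp ∧ 0 < κm) → C₁.im = 0 ∧ C₂.im = 0) ∧
      ∀ τ ∈ J, ((deriv r τ : ℝ) : ℂ) ^ 2 =
        (κm : ℂ) / (Δ : ℂ) ^ 2 * ((r τ : ℂ) ^ 2 - C₁) * ((r τ : ℂ) ^ 2 - C₂) := by
  have h1 : κ₁ ^ 2 = 1 := by rcases hκ₁ with rfl | rfl <;> norm_num
  have hκ₁0 : κ₁ ≠ 0 := by rintro rfl; norm_num at h1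
  obtain ⟨C₁, C₂, hroots, him, hfac⟩ := aroots_quadratic (a := κ₁ * κm)
    (b := Δ ^ 2 + 2 * κ₁ * ε * C) (c := κ₁ * κp * C ^ 2) (mul_ne_zero hκ₁0 hκm)
  refine ⟨C₁, C₂, hroots, fun hn => him ?_, fun τ hτ => ?_⟩
  · rw [show (Δ ^ 2 + 2 * κ₁ * ε * C) ^ 2 - 4 * (κ₁ * κm) * (κ₁ * κp * C ^ 2)
      = (Δ ^ 2 + 2 * κ₁ * ε * C) ^ 2 - 4 * κm * κp * C ^ 2 by
        linear_combination (-4 * κm * κp * C ^ 2) * h1]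
    rcases lt_or_gt_of_ne hκm with hm | hm
    · obtain ⟨t, ht⟩ := hJn
      have hN : 0 ≤ κm * (r t ^ 2) ^ 2 + (κ₁ * Δ ^ 2 + 2 * ε * C) * r t ^ 2 + κp * C ^ 2 := by
        have h := hr t ht
        rw [eq_div_iff (pow_ne_zero 2 hΔ0)] at h
        rw [← h]; positivity
      have h4 := mul_nonneg (neg_nonneg.2 hm.le) hN
      have e : (Δ ^ 2 + 2 * κ₁ * ε * C) ^ 2 - 4 * κm * κp * C ^ 2
          = (2 * κm * r t ^ 2 + (κ₁ * Δ ^ 2 + 2 * ε * C)) ^ 2 + 4 * (-κm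
            * (κm * (r t ^ 2) ^ 2 + (κ₁ * Δ ^ 2 + 2 * ε * C) * r t ^ 2 + κp * C ^ 2)) := by
        linear_combination (4 * ε ^ 2 * C ^ 2 - Δ ^ 4) * h1
      rw [e]
      positivity
    · have hp : κp ≤ 0 := by by_contra! h; exact hn ⟨h, hm⟩
      have : κm * κp * C ^ 2 ≤ 0 := mul_nonpos_of_nonpos_of_nonneg
        (mul_nonpos_of_nonneg_of_nonpos hm.le hp) (sq_nonneg C)
      nlinarith [sq_nonneg (Δ ^ 2 + 2 * κ₁ * ε * C)]
  · have hΔc : (Δ : ℂ) ≠ 0 := by exact_mod_cast hΔ0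
    have h1c : (κ₁ : ℂ) ^ 2 = 1 := by exact_mod_cast h1
    have hf := hfac ((r τ : ℂ) ^ 2)
    have h := congrArg (fun z : ℝ => (z : ℂ)) (hr τ hτ)
    push_cast at h hf
    rw [h]
    field_simp
    linear_combination κ₁ * hf
      + (-(κm * ((r τ : ℂ) ^ 2) ^ 2 + 2 * ε * C * (r τ : ℂ) ^ 2 + κp * C ^ 2)
      + κm * ((r τ : ℂ) ^ 2 - C₁) * ((r τ : ℂ) ^ 2 - C₂)) * h1c

/-! ### Frames adapted to the rotation planes -/

/-- Two linear sphere complexes `pp, pm` that span a non-degenerate plane, together with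
orthonormal bases `v₁, e₁` and `v₂, e₂` of two orthogonal planes perpendicular to them. That these
six vectors span `ℝ^{4,2}` is encoded in `complete`: no other vector is perpendicular to them. -/
structure AdaptedFrame where
  (pp pm v₁ e₁ v₂ e₂ : R42)
  (κ₁ κ₂ κp κm ε : ℝ)
  sign₁ : κ₁ = 1 ∨ κ₁ = -1
  sign₂ : κ₂ = 1 ∨ κ₂ = -1
  pp_pp : ip pp pp = κp
  pm_pm : ip pm pm = κm
  pp_pm : ip pp pm = ε
  v₁_v₁ : ip v₁ v₁ = κ₁
  e₁_e₁ : ip e₁ e₁ = 1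
  v₂_v₂ : ip v₂ v₂ = κ₂
  e₂_e₂ : ip e₂ e₂ = 1
  v₁_e₁ : ip v₁ e₁ = 0
  v₂_e₂ : ip v₂ e₂ = 0
  v₁_v₂ : ip v₁ v₂ = 0
  v₁_e₂ : ip v₁ e₂ = 0
  e₁_v₂ : ip e₁ v₂ = 0
  e₁_e₂ : ip e₁ e₂ = 0
  v₁_pp : ip v₁ pp = 0
  v₁_pm : ip v₁ pm = 0
  e₁_pp : ip e₁ pp = 0
  e₁_pm : ip e₁ pm = 0
  v₂_pp : ip v₂ pp = 0
  v₂_pm : ip v₂ pm = 0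
  e₂_pp : ip e₂ pp = 0
  e₂_pm : ip e₂ pm = 0
  pos : 0 < κ₁ * κ₂ / (κp * κm - ε ^ 2)
  complete : ∀ z, ip z pp = 0 → ip z pm = 0 → ip z v₁ = 0 → ip z e₁ = 0 → ip z v₂ = 0 →
    ip z e₂ = 0 → z = 0

namespace AdaptedFrame

variable (B : AdaptedFrame)

/-- The Gram determinant of the linear sphere complexes. -/
def Δ : ℝ := B.κp * B.κm - B.ε ^ 2

/-- The vector with given coefficients in an adapted frame. -/
def vec (a b r s x y : ℝ) : R42 :=
  a • B.pp + b • B.pm + r • B.v₁ + s • B.e₁ + x • B.v₂ + y • B.e₂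

lemma Δ_ne_zero : B.Δ ≠ 0 := by
  intro h
  have := B.pos
  rw [show B.κp * B.κm - B.ε ^ 2 = 0 from h] at this
  simp at this

lemma κ₁_mul_self : B.κ₁ * B.κ₁ = 1 := by rcases B.sign₁ with h | h <;> rw [h] <;> norm_num

lemma κ₂_mul_self : B.κ₂ * B.κ₂ = 1 := by rcases B.sign₂ with h | h <;> rw [h] <;> norm_num

lemma ip_vec_pp (a b r s x y : ℝ) : ip (B.vec a b r s x y) B.pp = a * B.κp + b * B.ε := by
  simp only [vec, ip_add_left, ip_smul_left, B.pp_pp, ip_comm B.pm B.pp, B.pp_pm, B.v₁_pp,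
    B.e₁_pp, B.v₂_pp, B.e₂_pp]
  ring

lemma ip_vec_pm (a b r s x y : ℝ) : ip (B.vec a b r s x y) B.pm = a * B.ε + b * B.κm := by
  simp only [vec, ip_add_left, ip_smul_left, B.pm_pm, B.pp_pm, B.v₁_pm, B.e₁_pm, B.v₂_pm,
    B.e₂_pm]
  ring

lemma ip_vec_v₁ (a b r s x y : ℝ) : ip (B.vec a b r s x y) B.v₁ = B.κ₁ * r := by
  simp only [vec, ip_add_left, ip_smul_left, ip_comm B.pp B.v₁, ip_comm B.pm B.v₁, B.v₁_pp,
    B.v₁_pm, B.v₁_v₁, ip_comm B.e₁ B.v₁, B.v₁_e₁, ip_comm B.v₂ B.v₁, B.v₁_v₂, ip_comm B.e₂ B.v₁,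
    B.v₁_e₂]
  ring

lemma ip_vec_e₁ (a b r s x y : ℝ) : ip (B.vec a b r s x y) B.e₁ = s := by
  simp only [vec, ip_add_left, ip_smul_left, ip_comm B.pp B.e₁, ip_comm B.pm B.e₁, B.e₁_pp,
    B.e₁_pm, B.e₁_e₁, B.v₁_e₁, ip_comm B.v₂ B.e₁, B.e₁_v₂, ip_comm B.e₂ B.e₁, B.e₁_e₂]
  ring

lemma ip_vec_v₂ (a b r s x y : ℝ) : ip (B.vec a b r s x y) B.v₂ = B.κ₂ * x := by
  simp only [vec, ip_add_left, ip_smul_left, ip_comm B.pp B.v₂, ip_comm B.pm B.v₂, B.v₂_pp,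
    B.v₂_pm, B.v₂_v₂, ip_comm B.e₂ B.v₂, B.v₂_e₂, B.v₁_v₂, B.e₁_v₂]
  ring

lemma ip_vec_e₂ (a b r s x y : ℝ) : ip (B.vec a b r s x y) B.e₂ = y := by
  simp only [vec, ip_add_left, ip_smul_left, ip_comm B.pp B.e₂, ip_comm B.pm B.e₂, B.e₂_pp,
    B.e₂_pm, B.e₂_e₂, B.v₂_e₂, B.v₁_e₂, B.e₁_e₂]
  ring

lemma ip_vec_vec (a b r s x y a' b' r' s' x' y' : ℝ) :
    ip (B.vec a b r s x y) (B.vec a' b' r' s' x' y')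
      = a' * (a * B.κp + b * B.ε) + b' * (a * B.ε + b * B.κm) + B.κ₁ * r * r' + s * s'
        + B.κ₂ * x * x' + y * y' := by
  conv_lhs => rw [vec.eq_1 B a' b' r' s' x' y']
  simp only [ip_add_right, ip_smul_right, B.ip_vec_pp, B.ip_vec_pm, B.ip_vec_v₁, B.ip_vec_e₁,
    B.ip_vec_v₂, B.ip_vec_e₂]
  ring

lemma vec_add (a b r s x y a' b' r' s' x' y' : ℝ) :
    B.vec a b r s x y + B.vec a' b' r' s' x' y'
      = B.vec (a + a') (b + b') (r + r') (s + s') (x + x') (y + y') := by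
  simp only [vec]; module

lemma smul_vec (c a b r s x y : ℝ) :
    c • B.vec a b r s x y = B.vec (c * a) (c * b) (c * r) (c * s) (c * x) (c * y) := by
  simp only [vec]; module

lemma vec_zero : B.vec 0 0 0 0 0 0 = 0 := by simp [vec]

lemma vec_eq_zero {r s x y : ℝ} (h : B.vec 0 0 r s x y = 0) :
    r = 0 ∧ s = 0 ∧ x = 0 ∧ y = 0 := by
  have h1 := B.ip_vec_v₁ 0 0 r s x y
  have h2 := B.ip_vec_e₁ 0 0 r s x y
  have h3 := B.ip_vec_v₂ 0 0 r s x y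
  have h4 := B.ip_vec_e₂ 0 0 r s x y
  rw [h, ip_zero_left] at h1 h2 h3 h4
  exact ⟨by linear_combination (-B.κ₁) * h1 - r * B.κ₁_mul_self, h2.symm,
    by linear_combination (-B.κ₂) * h3 - x * B.κ₂_mul_self, h4.symm⟩

/-- A vector perpendicular to `e₁` is determined by its inner products with the other vectors of
the frame. -/
lemma eq_vec {z : R42} {a b : ℝ} (hp : ip z B.pp = a * B.κp + b * B.ε)
    (hm : ip z B.pm = a * B.ε + b * B.κm) (he : ip z B.e₁ = 0) :
    z = B.vec a b (B.κ₁ * ip z B.v₁) 0 (B.κ₂ * ip z B.v₂) (ip z B.e₂) := by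
  rw [← sub_eq_zero]
  apply B.complete
  · rw [ip_sub_left, ip_vec_pp, hp, sub_self]
  · rw [ip_sub_left, ip_vec_pm, hm, sub_self]
  · rw [ip_sub_left, ip_vec_v₁]; linear_combination (-ip z B.v₁) * B.κ₁_mul_self
  · rw [ip_sub_left, ip_vec_e₁, he, sub_self]
  · rw [ip_sub_left, ip_vec_v₂]; linear_combination (-ip z B.v₂) * B.κ₂_mul_self
  · rw [ip_sub_left, ip_vec_e₂, sub_self]

lemma rot₁_vec (a b r x y θ : ℝ) :
    rot B.v₁ B.e₁ B.κ₁ θ (B.vec a b r 0 x y)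
      = B.vec a b (r * kcos B.κ₁ θ) (r * ksin B.κ₁ θ) x y := by
  rw [rot_of_ip_eq_zero _ _ (B.ip_vec_e₁ _ _ _ _ _ _), B.ip_vec_v₁,
    show B.κ₁ * (B.κ₁ * r) = r by linear_combination r * B.κ₁_mul_self]
  simp only [vec]; module

/-- The factor `σ = ±1` reverses the orientation of the rotations. -/
lemma rot₂_vec {σ : ℝ} (a b r d ψ : ℝ) :
    rot B.v₂ (σ • B.e₂) B.κ₂ ψ (B.vec a b r 0 d 0)
      = B.vec a b r 0 (d * kcos B.κ₂ ψ) (σ * (d * ksin B.κ₂ ψ)) := by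
  rw [rot_of_ip_eq_zero _ _ (by rw [ip_smul_right, B.ip_vec_e₂, mul_zero]), B.ip_vec_v₂,
    show B.κ₂ * (B.κ₂ * d) = d by linear_combination d * B.κ₂_mul_self]
  simp only [vec]; module

/-- The surface obtained by rotating the curve with components `r, x, y`. -/
def surface (a b : ℝ) (r x y : ℝ → ℝ) (p : ℝ × ℝ) : R42 :=
  B.vec a b (r p.2 * kcos B.κ₁ p.1) (r p.2 * ksin B.κ₁ p.1) (x p.2) (y p.2)

lemma exists_hasFDerivAt_surface {a b : ℝ} {r x y : ℝ → ℝ} {dr dx dy θ t : ℝ}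
    (hr : HasDerivAt r dr t) (hx : HasDerivAt x dx t) (hy : HasDerivAt y dy t) :
    ∃ L : ℝ × ℝ →L[ℝ] R42, HasFDerivAt (B.surface a b r x y) L (θ, t) ∧
      ∀ X : ℝ × ℝ, L X = B.vec 0 0
        (X.2 * (dr * kcos B.κ₁ θ) - X.1 * (r t * (B.κ₁ * ksin B.κ₁ θ)))
        (X.2 * (dr * ksin B.κ₁ θ) + X.1 * (r t * kcos B.κ₁ θ)) (X.2 * dx) (X.2 * dy) := by
  have h2 : HasFDerivAt (fun p : ℝ × ℝ => p.2) (ContinuousLinearMap.snd ℝ ℝ ℝ) (θ, t) :=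
    hasFDerivAt_snd
  have h1 : HasFDerivAt (fun p : ℝ × ℝ => p.1) (ContinuousLinearMap.fst ℝ ℝ ℝ) (θ, t) :=
    hasFDerivAt_fst
  have fr := HasDerivAt.comp_hasFDerivAt (θ, t) (h₂ := r) (f := fun p : ℝ × ℝ => p.2) hr h2
  have fx := HasDerivAt.comp_hasFDerivAt (θ, t) (h₂ := x) (f := fun p : ℝ × ℝ => p.2) hx h2
  have fy := HasDerivAt.comp_hasFDerivAt (θ, t) (h₂ := y) (f := fun p : ℝ × ℝ => p.2) hy h2
  have fc := HasDerivAt.comp_hasFDerivAt (θ, t) (h₂ := kcos B.κ₁) (f := fun p : ℝ × ℝ => p.1)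
    (hasDerivAt_kcos B.sign₁ θ) h1
  have fs := HasDerivAt.comp_hasFDerivAt (θ, t) (h₂ := ksin B.κ₁) (f := fun p : ℝ × ℝ => p.1)
    (hasDerivAt_ksin B.sign₁ θ) h1
  have key := (((((hasFDerivAt_const (a • B.pp + b • B.pm) ((θ, t) : ℝ × ℝ)).add
    ((fr.mul fc).smul_const B.v₁)).add ((fr.mul fs).smul_const B.e₁)).add
    (fx.smul_const B.v₂)).add (fy.smul_const B.e₂))
  refine ⟨_, key, fun X => ?_⟩
  simp [vec]
  module

end AdaptedFrame

/-! ### Normalized lifts -/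

/-- The plane `p^⊥` has signature `(4,1)` and contains no null plane: a contact element that
contains the point `f` of the space form contains no other sphere perpendicular to `p` and `q`. -/
lemma eq_zero_of_perp_spaceForm {p q f w : R42} (hpp : ip p p = -1) (hff : ip f f = 0)
    (hww : ip w w = 0) (hfw : ip w f = 0) (hfp : ip f p = 0) (hfq : ip f q = -1)
    (hwp : ip w p = 0) (hwq : ip w q = 0) : w = 0 := by
  obtain ⟨u, v, c, hne, h⟩ := exists_relation_of_nonpos hww hff (by rw [hpp]; norm_num)
    hfw hwp hfp
  have h1 := congrArg (fun z => ip z p) h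
  simp only [ip_add_left, ip_smul_left, hwp, hfp, hpp, ip_zero_left] at h1
  have hc : c = 0 := by linarith
  subst hc
  have h2 := congrArg (fun z => ip z q) h
  simp only [ip_add_left, ip_smul_left, hwq, hfq, ip_zero_left] at h2
  have hv : v = 0 := by linarith
  subst hv
  have hu : u ≠ 0 := by simpa using hne
  simpa [hu] using h

lemma IsLift.normalize {D : Set (ℝ × ℝ)} {s : ℝ × ℝ → Submodule ℝ R42} {σ : ℝ × ℝ → R42}
    (h : IsLift D s σ) {n : R42} (hn : ∀ x ∈ D, ip (σ x) n ≠ 0) {c : ℝ} (hc : c ≠ 0) :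
    IsLift D s (fun x => (c / ip (σ x) n) • σ x) where
  smooth := (contDiffOn_const.div ((ipL n).contDiff.comp_contDiffOn h.smooth) hn).smul h.smooth
  ne_zero x hx := smul_ne_zero (div_ne_zero hc (hn x hx)) (h.ne_zero x hx)
  lightlike x hx := by rw [ip_smul_left, ip_smul_right, h.lightlike x hx]; ring
  spans x hx := by
    rw [h.spans x hx, Submodule.span_singleton_smul_eq (IsUnit.mk0 _ (div_ne_zero hc (hn x hx)))]

/-- Sections `f, g` of a family `Λ` of null planes that are normalized by the linear sphere
complexes: `f` is perpendicular to `pp`, `g` is perpendicular to `pm`, and `(f, pm)`, `(g, pp)` are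
the Gram determinant of `pp, pm`. By `perp`, the sections span the planes. -/
structure IsNormalizedPair (B : AdaptedFrame) (D : Set (ℝ × ℝ)) (Λ : ℝ × ℝ → Submodule ℝ R42)
    (f g : ℝ × ℝ → R42) : Prop where
  f_section : IsSection D Λ f
  g_section : IsSection D Λ g
  null : ∀ x ∈ D, ∀ a ∈ Λ x, ∀ b ∈ Λ x, ip a b = 0
  f_pp : ∀ x ∈ D, ip (f x) B.pp = 0
  f_pm : ∀ x ∈ D, ip (f x) B.pm = B.Δ
  g_pp : ∀ x ∈ D, ip (g x) B.pp = B.Δ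
  g_pm : ∀ x ∈ D, ip (g x) B.pm = 0
  perp : ∀ x ∈ D, ∀ w ∈ Λ x, ip w B.pp = 0 → ip w B.pm = 0 → w = 0

namespace IsNormalizedPair

variable {B : AdaptedFrame} {D : Set (ℝ × ℝ)} {Λ : ℝ × ℝ → Submodule ℝ R42} {f g : ℝ × ℝ → R42}

lemma eq_of_mem (h : IsNormalizedPair B D Λ f g) {x : ℝ × ℝ} (hx : x ∈ D) {w w' : R42}
    (hw : w ∈ Λ x) (hw' : w' ∈ Λ x) (hp : ip w B.pp = ip w' B.pp) (hm : ip w B.pm = ip w' B.pm) :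
    w = w' := by
  rw [← sub_eq_zero]
  refine h.perp x hx _ (Submodule.sub_mem _ hw hw') ?_ ?_
  · rw [ip_sub_left, hp, sub_self]
  · rw [ip_sub_left, hm, sub_self]

lemma eq_combination (h : IsNormalizedPair B D Λ f g) {x : ℝ × ℝ} (hx : x ∈ D) {w : R42}
    (hw : w ∈ Λ x) :
    w = (B.Δ⁻¹ * ip w B.pm) • f x + (B.Δ⁻¹ * ip w B.pp) • g x := by
  have hΔ := B.Δ_ne_zero
  refine h.eq_of_mem hx hw (Submodule.add_mem _ (Submodule.smul_mem _ _ (h.f_section.mem x hx))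
    (Submodule.smul_mem _ _ (h.g_section.mem x hx))) ?_ ?_
  · rw [ip_add_left, ip_smul_left, ip_smul_left, h.f_pp x hx, h.g_pp x hx]; field_simp; ring
  · rw [ip_add_left, ip_smul_left, ip_smul_left, h.f_pm x hx, h.g_pm x hx]; field_simp; ring

/-- Modulo the contact element, the derivative of a section is the combination of the derivatives
of the normalized sections with the same coefficients. -/
lemma fderiv_section_mem_iff (h : IsNormalizedPair B D Λ f g) (hD : IsOpen D)
    {A : ℝ × ℝ → R42} (hA : IsSection D Λ A) {x : ℝ × ℝ} (hx : x ∈ D)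
    {F G : ℝ × ℝ →L[ℝ] R42} (hF : HasFDerivAt f F x) (hG : HasFDerivAt g G x) (X : ℝ × ℝ) :
    fderiv ℝ A x X ∈ Λ x ↔
      (B.Δ⁻¹ * ip (A x) B.pm) • F X + (B.Δ⁻¹ * ip (A x) B.pp) • G X ∈ Λ x := by
  have dA : HasFDerivAt A (fderiv ℝ A x) x :=
    (((hA.smooth x hx).contDiffAt (hD.mem_nhds hx)).differentiableAt (by simp)).hasFDerivAt
  have dm : HasFDerivAt (fun y => B.Δ⁻¹ * ip (A y) B.pm)
      (B.Δ⁻¹ • (ipL B.pm).comp (fderiv ℝ A x)) x :=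
    ((ipL B.pm).hasFDerivAt.comp x dA).const_mul _
  have dp : HasFDerivAt (fun y => B.Δ⁻¹ * ip (A y) B.pp)
      (B.Δ⁻¹ • (ipL B.pp).comp (fderiv ℝ A x)) x :=
    ((ipL B.pp).hasFDerivAt.comp x dA).const_mul _
  have key := ((dm.smul hF).add (dp.smul hG)).congr_of_eventuallyEq (f₁ := A) (by
    filter_upwards [hD.mem_nhds hx] with y hy using h.eq_combination hy (hA.mem y hy))
  rw [key.fderiv]
  simp only [add_apply, smul_apply,
    ContinuousLinearMap.smulRight_apply, ContinuousLinearMap.comp_apply, ipL_apply]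
  have hf := h.f_section.mem x hx
  have hg := h.g_section.mem x hx
  rw [add_add_add_comm]
  exact Submodule.add_mem_iff_left _
    (Submodule.add_mem _ (Submodule.smul_mem _ _ hf) (Submodule.smul_mem _ _ hg))

end IsNormalizedPair

/-- For a rotational family of null planes, the normalized lifts are obtained by rotating their
profile curves, by uniqueness. -/
lemma IsNormalizedPair.rotational {B : AdaptedFrame} {I : Set ℝ} {Λ : ℝ × ℝ → Submodule ℝ R42}
    {f g : ℝ × ℝ → R42} (h : IsNormalizedPair B (Set.univ ×ˢ I) Λ f g)
    (hrot : IsRotational I B.v₁ B.e₁ B.κ₁ Λ) {t : ℝ} (ht : t ∈ I) :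
    (∀ w ∈ Λ (0, t), ip w B.e₁ = 0) ∧
      ∀ θ, f (θ, t) = rot B.v₁ B.e₁ B.κ₁ θ (f (0, t)) ∧
        g (θ, t) = rot B.v₁ B.e₁ B.κ₁ θ (g (0, t)) := by
  obtain ⟨c₁, c₂, -, -, h₁, h₂, hspan⟩ := hrot
  have h0 := hspan 0 t ht
  simp only [rot_zero_angle] at h0
  have hD : ∀ θ : ℝ, (θ, t) ∈ (Set.univ ×ˢ I : Set (ℝ × ℝ)) := fun θ => ⟨trivial, ht⟩
  have hmem : ∀ w ∈ Λ (0, t), ∀ θ, rot B.v₁ B.e₁ B.κ₁ θ w ∈ Λ (θ, t) := by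
    intro w hw θ
    rw [h0, Submodule.mem_span_pair] at hw
    obtain ⟨a, b, rfl⟩ := hw
    rw [hspan θ t ht, Submodule.mem_span_pair, rot_add, rot_smul, rot_smul]
    exact ⟨a, b, rfl⟩
  refine ⟨fun w hw => ?_, fun θ => ⟨?_, ?_⟩⟩
  · rw [h0, Submodule.mem_span_pair] at hw
    obtain ⟨a, b, rfl⟩ := hw
    rw [ip_add_left, ip_smul_left, ip_smul_left, (h₁ t ht).2.2, (h₂ t ht).2.2]; ring
  · refine h.eq_of_mem (hD θ) (h.f_section.mem _ (hD θ)) (hmem _ (h.f_section.mem _ (hD 0)) θ) ?_ ?_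
    · rw [ip_rot_of_perp B.v₁_pp B.e₁_pp, h.f_pp _ (hD θ), h.f_pp _ (hD 0)]
    · rw [ip_rot_of_perp B.v₁_pm B.e₁_pm, h.f_pm _ (hD θ), h.f_pm _ (hD 0)]
  · refine h.eq_of_mem (hD θ) (h.g_section.mem _ (hD θ)) (hmem _ (h.g_section.mem _ (hD 0)) θ) ?_ ?_
    · rw [ip_rot_of_perp B.v₁_pp B.e₁_pp, h.g_pp _ (hD θ), h.g_pp _ (hD 0)]
    · rw [ip_rot_of_perp B.v₁_pm B.e₁_pm, h.g_pm _ (hD θ), h.g_pm _ (hD 0)]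

/-! ### Duality of the profile curves -/

/-- The profile curves of a rotational pair of Christoffel dual sphere congruences: `r, x, y` and
`R, X, Y` are the components of the normalized lifts along `v₁, v₂, e₂`. -/
structure IsDualProfile (B : AdaptedFrame) (I : Set ℝ) (r x y R X Y : ℝ → ℝ) : Prop where
  r_smooth : ContDiffOn ℝ ∞ r I
  x_smooth : ContDiffOn ℝ ∞ x I
  y_smooth : ContDiffOn ℝ ∞ y I
  R_smooth : ContDiffOn ℝ ∞ R I
  X_smooth : ContDiffOn ℝ ∞ X I
  Y_smooth : ContDiffOn ℝ ∞ Y I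
  norm_f : ∀ t ∈ I, B.κ₁ * r t ^ 2 + B.κ₂ * x t ^ 2 + y t ^ 2 = -(B.κp * B.Δ)
  norm_g : ∀ t ∈ I, B.κ₁ * R t ^ 2 + B.κ₂ * X t ^ 2 + Y t ^ 2 = -(B.κm * B.Δ)
  ip_f_g : ∀ t ∈ I, B.κ₁ * r t * R t + B.κ₂ * x t * X t + y t * Y t = B.ε * B.Δ
  normal_f : ∀ t ∈ I, B.κ₁ * r t * deriv r t + B.κ₂ * x t * deriv x t + y t * deriv y t = 0
  normal_g : ∀ t ∈ I, B.κ₁ * R t * deriv r t + B.κ₂ * X t * deriv x t + Y t * deriv y t = 0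
  r_ne_zero : ∀ t ∈ I, r t ≠ 0
  dual_r : ∀ t ∈ I, r t * deriv R t = -(R t * deriv r t)
  dual_x : ∀ t ∈ I, r t * deriv X t = -(R t * deriv x t)
  dual_y : ∀ t ∈ I, r t * deriv Y t = -(R t * deriv y t)
  speed_pos : ∀ t ∈ I, 0 < B.κ₁ * deriv r t ^ 2 + B.κ₂ * deriv x t ^ 2 + deriv y t ^ 2

/-- Linear independent directions of the parameter plane have nonzero determinant. -/
lemma det_ne_zero_of_linearIndependent {X Y : ℝ × ℝ} (h : LinearIndependent ℝ ![X, Y]) :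
    X.1 * Y.2 - X.2 * Y.1 ≠ 0 := by
  intro h0
  rw [LinearIndependent.pair_iff] at h
  obtain ⟨h1, h2⟩ := h Y.2 (-X.2) (by ext <;> simp <;> linarith)
  obtain ⟨h3, h4⟩ := h Y.1 (-X.1) (by ext <;> simp <;> linarith)
  have hX : X = 0 := by ext <;> simp <;> linarith
  have := (h 1 0 (by simp [hX])).1
  norm_num at this

/-- The pointwise effect of harmonic separation: if `α a' + β b'` vanishes in one direction and
`α a' - β b'` in another, then the coordinate directions are these two, and the derivatives of the
pair along the profile curve are opposite multiples, with the ratio of the radii `r, R`. -/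
lemma dual_of_harmonic {α β r R X₁ X₂ Y₁ Y₂ : ℝ} (hα : α ≠ 0) (hβ : β ≠ 0)
    (hdet : X₁ * Y₂ - X₂ * Y₁ ≠ 0) (hX : X₁ * (α * r + β * R) = 0)
    (hY : Y₁ * (α * r - β * R) = 0) (hr : r ≠ 0) {d D : ℝ}
    (hX' : X₂ * (α * d + β * D) = 0) (hY' : Y₂ * (α * d - β * D) = 0) :
    r * D = -(R * d) := by
  apply mul_left_cancel₀ hβ
  by_cases h1 : X₁ = 0
  · have hX2 : X₂ ≠ 0 := by rintro rfl; simp [h1] at hdet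
    have hY1 : Y₁ ≠ 0 := by rintro rfl; simp [h1] at hdet
    have e1 := (mul_eq_zero.1 hX').resolve_left hX2
    have e2 := (mul_eq_zero.1 hY).resolve_left hY1
    linear_combination r * e1 - d * e2
  · have e1 := (mul_eq_zero.1 hX).resolve_left h1
    have hne : α * r - β * R ≠ 0 := by
      intro h2
      exact mul_ne_zero hα hr (by linarith)
    have hY1 := (mul_eq_zero.1 hY).resolve_right hne
    have hY2 : Y₂ ≠ 0 := by rintro rfl; simp [hY1] at hdet
    have e2 := (mul_eq_zero.1 hY').resolve_left hY2
    linear_combination d * e1 - r * e2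

/-- The components of the normalized lifts of a rotational Ω-surface are dual profile curves. -/
lemma exists_dualProfile {B : AdaptedFrame} {I : Set ℝ} (hI : IsOpen I)
    {Λ sp sm : ℝ × ℝ → Submodule ℝ R42} {f g : ℝ × ℝ → R42}
    (hΛ : IsLegendreImmersion (Set.univ ×ˢ I) Λ)
    (hharm : ∀ x ∈ (Set.univ ×ˢ I : Set (ℝ × ℝ)),
      SeparatesHarmonicallyAt (Set.univ ×ˢ I) Λ sp sm x)
    (hf : IsLift (Set.univ ×ˢ I) sp f) (hg : IsLift (Set.univ ×ˢ I) sm g)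
    (h : IsNormalizedPair B (Set.univ ×ˢ I) Λ f g) (hrot : IsRotational I B.v₁ B.e₁ B.κ₁ Λ) :
    ∃ r x y R X Y : ℝ → ℝ, IsDualProfile B I r x y R X Y ∧
      (∀ p ∈ (Set.univ ×ˢ I : Set (ℝ × ℝ)), f p = B.surface (-B.ε) B.κp r x y p) ∧
      (∀ p ∈ (Set.univ ×ˢ I : Set (ℝ × ℝ)), g p = B.surface B.κm (-B.ε) R X Y p) := by
  have hD : IsOpen (Set.univ ×ˢ I : Set (ℝ × ℝ)) := isOpen_univ.prod hI
  have hD0 : ∀ {t}, t ∈ I → ((0 : ℝ), t) ∈ (Set.univ ×ˢ I : Set (ℝ × ℝ)) := fun ht => ⟨trivial, ht⟩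
  have hΔ : B.Δ = B.κp * B.κm - B.ε ^ 2 := rfl
  have hΔ0 := B.Δ_ne_zero
  set r : ℝ → ℝ := fun t => B.κ₁ * ip (f (0, t)) B.v₁ with hr
  set x : ℝ → ℝ := fun t => B.κ₂ * ip (f (0, t)) B.v₂ with hx
  set y : ℝ → ℝ := fun t => ip (f (0, t)) B.e₂ with hy
  set R : ℝ → ℝ := fun t => B.κ₁ * ip (g (0, t)) B.v₁ with hR
  set X : ℝ → ℝ := fun t => B.κ₂ * ip (g (0, t)) B.v₂ with hX
  set Y : ℝ → ℝ := fun t => ip (g (0, t)) B.e₂ with hY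
  have sm0 : ∀ {k : ℝ × ℝ → R42}, ContDiffOn ℝ ∞ k (Set.univ ×ˢ I) → ∀ n : R42,
      ContDiffOn ℝ ∞ (fun t => ip (k (0, t)) n) I := fun {k} hk n =>
    (ipL n).contDiff.comp_contDiffOn
      (hk.comp (contDiff_const.prodMk contDiff_id).contDiffOn fun t ht => hD0 ht)
  have hrs : ContDiffOn ℝ ∞ r I := contDiffOn_const.mul (sm0 hf.smooth _)
  have hxs : ContDiffOn ℝ ∞ x I := contDiffOn_const.mul (sm0 hf.smooth _)
  have hys : ContDiffOn ℝ ∞ y I := sm0 hf.smooth _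
  have hRs : ContDiffOn ℝ ∞ R I := contDiffOn_const.mul (sm0 hg.smooth _)
  have hXs : ContDiffOn ℝ ∞ X I := contDiffOn_const.mul (sm0 hg.smooth _)
  have hYs : ContDiffOn ℝ ∞ Y I := sm0 hg.smooth _
  have hf0 : ∀ t ∈ I, f (0, t) = B.vec (-B.ε) B.κp (r t) 0 (x t) (y t) := fun t ht =>
    B.eq_vec (by rw [h.f_pp _ (hD0 ht)]; ring) (by rw [h.f_pm _ (hD0 ht), hΔ]; ring)
      ((h.rotational hrot ht).1 _ (h.f_section.mem _ (hD0 ht)))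
  have hg0 : ∀ t ∈ I, g (0, t) = B.vec B.κm (-B.ε) (R t) 0 (X t) (Y t) := fun t ht =>
    B.eq_vec (by rw [h.g_pp _ (hD0 ht), hΔ]; ring) (by rw [h.g_pm _ (hD0 ht)]; ring)
      ((h.rotational hrot ht).1 _ (h.g_section.mem _ (hD0 ht)))
  have hfs : ∀ p ∈ (Set.univ ×ˢ I : Set (ℝ × ℝ)), f p = B.surface (-B.ε) B.κp r x y p := by
    rintro ⟨θ, t⟩ ⟨-, ht⟩
    rw [((h.rotational hrot ht).2 θ).1, hf0 t ht, B.rot₁_vec]; rfl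
  have hgs : ∀ p ∈ (Set.univ ×ˢ I : Set (ℝ × ℝ)), g p = B.surface B.κm (-B.ε) R X Y p := by
    rintro ⟨θ, t⟩ ⟨-, ht⟩
    rw [((h.rotational hrot ht).2 θ).2, hg0 t ht, B.rot₁_vec]; rfl
  have hder : ∀ t ∈ I, ∃ F G : ℝ × ℝ →L[ℝ] R42, HasFDerivAt f F (0, t) ∧ HasFDerivAt g G (0, t) ∧
      (∀ Z, F Z = B.vec 0 0 (Z.2 * deriv r t) (Z.1 * r t) (Z.2 * deriv x t) (Z.2 * deriv y t)) ∧
      (∀ Z, G Z = B.vec 0 0 (Z.2 * deriv R t) (Z.1 * R t) (Z.2 * deriv X t) (Z.2 * deriv Y t)) := by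
    intro t ht
    obtain ⟨F, hF, hF'⟩ := B.exists_hasFDerivAt_surface (a := -B.ε) (b := B.κp) (θ := 0)
      (hasDerivAt_of_contDiffOn hI hrs ht) (hasDerivAt_of_contDiffOn hI hxs ht)
      (hasDerivAt_of_contDiffOn hI hys ht)
    obtain ⟨G, hG, hG'⟩ := B.exists_hasFDerivAt_surface (a := B.κm) (b := -B.ε) (θ := 0)
      (hasDerivAt_of_contDiffOn hI hRs ht) (hasDerivAt_of_contDiffOn hI hXs ht)
      (hasDerivAt_of_contDiffOn hI hYs ht)
    refine ⟨F, G, hF.congr_of_eventuallyEq ?_, hG.congr_of_eventuallyEq ?_, fun Z => ?_,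
      fun Z => ?_⟩
    · filter_upwards [hD.mem_nhds (hD0 ht)] with p hp using hfs p hp
    · filter_upwards [hD.mem_nhds (hD0 ht)] with p hp using hgs p hp
    · rw [hF']; simp [kcos_zero, ksin_zero]
    · rw [hG']; simp [kcos_zero, ksin_zero]
  -- the immersion condition, in terms of the normalized lifts
  have himm : ∀ t ∈ I, ∀ F G : ℝ × ℝ →L[ℝ] R42, HasFDerivAt f F (0, t) → HasFDerivAt g G (0, t) →
      ∀ Z, F Z = 0 → G Z = 0 → Z = 0 := by
    intro t ht F G hF hG Z hFZ hGZ
    refine hΛ.immersion _ (hD0 ht) Z fun A hA => ?_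
    rw [h.fderiv_section_mem_iff hD hA (hD0 ht) hF hG, hFZ, hGZ]
    simp
  have hpoint : ∀ t ∈ I, r t ≠ 0 ∧ r t * deriv R t = -(R t * deriv r t) ∧
      r t * deriv X t = -(R t * deriv x t) ∧ r t * deriv Y t = -(R t * deriv y t) := by
    intro t ht
    obtain ⟨F, G, hF, hG, hF', hG'⟩ := hder t ht
    obtain ⟨a, ha, b, hb, ha0, hb0, Z, W, hZW, ⟨-, A, hA, hAx, hAZ⟩, ⟨-, A', hA', hAx', hAW⟩⟩ :=
      hharm (0, t) (hD0 ht)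
    have hdet := det_ne_zero_of_linearIndependent hZW
    rw [hf.spans _ (hD0 ht), Submodule.mem_span_singleton] at ha
    rw [hg.spans _ (hD0 ht), Submodule.mem_span_singleton] at hb
    obtain ⟨α, rfl⟩ := ha
    obtain ⟨β, rfl⟩ := hb
    have hα : α ≠ 0 := by rintro rfl; simp at ha0
    have hβ : β ≠ 0 := by rintro rfl; simp at hb0
    have fpp := h.f_pp _ (hD0 ht)
    have fpm := h.f_pm _ (hD0 ht)
    have gpp := h.g_pp _ (hD0 ht)
    have gpm := h.g_pm _ (hD0 ht)
    rw [h.fderiv_section_mem_iff hD hA (hD0 ht) hF hG, hAx] at hAZ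
    rw [h.fderiv_section_mem_iff hD hA' (hD0 ht) hF hG, hAx'] at hAW
    simp only [ip_add_left, ip_sub_left, ip_smul_left, fpp, fpm, gpp, gpm, mul_zero, add_zero,
      zero_add, sub_zero, zero_sub] at hAZ hAW
    rw [show B.Δ⁻¹ * (α * B.Δ) = α by field_simp, show B.Δ⁻¹ * (β * B.Δ) = β by field_simp,
      hF', hG', B.smul_vec, B.smul_vec, B.vec_add] at hAZ
    rw [show B.Δ⁻¹ * (α * B.Δ) = α by field_simp, show B.Δ⁻¹ * -(β * B.Δ) = -β by field_simp,
      hF', hG', B.smul_vec, B.smul_vec, B.vec_add] at hAW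
    simp only [mul_zero, add_zero] at hAZ hAW
    obtain ⟨z1, z2, z3, z4⟩ := B.vec_eq_zero (h.perp _ (hD0 ht) _ hAZ
      (by rw [B.ip_vec_pp]; ring) (by rw [B.ip_vec_pm]; ring))
    obtain ⟨w1, w2, w3, w4⟩ := B.vec_eq_zero (h.perp _ (hD0 ht) _ hAW
      (by rw [B.ip_vec_pp]; ring) (by rw [B.ip_vec_pm]; ring))
    have hr0 : r t ≠ 0 := by
      -- if `r` vanishes then so does `R`, and the surface is not immersed in the rotation direction
      intro hr0
      have hR0 : R t = 0 := by
        by_contra hR0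
        rw [hr0] at z2 w2
        have hz : Z.1 = 0 := by simpa [hβ, hR0] using z2
        have hw : W.1 = 0 := by simpa [hβ, hR0] using w2
        exact hdet (by rw [hz, hw]; ring)
      have := himm t ht F G hF hG (1, 0) (by rw [hF', hr0]; simpa using B.vec_zero)
        (by rw [hG', hR0]; simpa using B.vec_zero)
      simp at this
    have hZ1 : Z.1 * (α * r t + β * R t) = 0 := by linear_combination z2
    have hW1 : W.1 * (α * r t - β * R t) = 0 := by linear_combination w2
    exact ⟨hr0,
      dual_of_harmonic hα hβ hdet hZ1 hW1 hr0 (by linear_combination z1) (by linear_combination w1),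
      dual_of_harmonic hα hβ hdet hZ1 hW1 hr0 (by linear_combination z3) (by linear_combination w3),
      dual_of_harmonic hα hβ hdet hZ1 hW1 hr0 (by linear_combination z4) (by linear_combination w4)⟩
  have hnormal : ∀ t ∈ I,
      B.κ₁ * r t * deriv r t + B.κ₂ * x t * deriv x t + y t * deriv y t = 0 ∧
      B.κ₁ * R t * deriv r t + B.κ₂ * X t * deriv x t + Y t * deriv y t = 0 := by
    intro t ht
    obtain ⟨F, G, hF, hG, hF', hG'⟩ := hder t ht
    have c1 := hΛ.contact f f h.f_section h.f_section (0, t) (hD0 ht) (0, 1)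
    have c2 := hΛ.contact f g h.f_section h.g_section (0, t) (hD0 ht) (0, 1)
    rw [hF.fderiv, hF', hf0 t ht, B.ip_vec_vec] at c1
    rw [hF.fderiv, hF', hg0 t ht, B.ip_vec_vec] at c2
    exact ⟨by linear_combination c1, by linear_combination c2⟩
  have hspeed : ∀ t ∈ I,
      0 < B.κ₁ * deriv r t ^ 2 + B.κ₂ * deriv x t ^ 2 + deriv y t ^ 2 := by
    intro t ht
    -- otherwise `f`, `g` and the tangent of the curve are dependent, so that the tangent vanishes
    by_contra! hle
    obtain ⟨F, G, hF, hG, hF', hG'⟩ := hder t ht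
    have hF01 : F (0, 1) = B.vec 0 0 (deriv r t) 0 (deriv x t) (deriv y t) := by
      rw [hF']; simp
    have hfm := h.f_section.mem _ (hD0 ht)
    have hgm := h.g_section.mem _ (hD0 ht)
    have c1 := hΛ.contact f f h.f_section h.f_section (0, t) (hD0 ht) (0, 1)
    have c2 := hΛ.contact f g h.f_section h.g_section (0, t) (hD0 ht) (0, 1)
    rw [hF.fderiv, ip_comm] at c1 c2
    obtain ⟨u, v, w, hne, hrel⟩ := exists_relation_of_nonpos (c := F (0, 1))
      (h.null _ (hD0 ht) _ hfm _ hfm) (h.null _ (hD0 ht) _ hgm _ hgm)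
      (by rw [hF01, B.ip_vec_vec]; linarith) (h.null _ (hD0 ht) _ hfm _ hgm) c1 c2
    have hm := congrArg (fun z => ip z B.pm) hrel
    have hp := congrArg (fun z => ip z B.pp) hrel
    simp only [ip_add_left, ip_smul_left, h.f_pp _ (hD0 ht), h.f_pm _ (hD0 ht), h.g_pp _ (hD0 ht),
      h.g_pm _ (hD0 ht), hF01, B.ip_vec_pp, B.ip_vec_pm, ip_zero_left] at hm hp
    have hu : u = 0 := by
      apply (mul_eq_zero.1 (show u * B.Δ = 0 by linarith)).resolve_right hΔ0
    have hv : v = 0 := by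
      apply (mul_eq_zero.1 (show v * B.Δ = 0 by linarith)).resolve_right hΔ0
    have hw : w ≠ 0 := by simpa [hu, hv] using hne
    rw [hu, hv, zero_smul, zero_smul, zero_add, zero_add] at hrel
    have hF0 := (smul_eq_zero.1 hrel).resolve_left hw
    obtain ⟨d1, -, d2, d3⟩ := B.vec_eq_zero (hF01 ▸ hF0)
    obtain ⟨hr0, e1, e2, e3⟩ := hpoint t ht
    rw [d1] at e1
    rw [d2] at e2
    rw [d3] at e3
    have e1' : deriv R t = 0 := by simpa [hr0] using e1
    have e2' : deriv X t = 0 := by simpa [hr0] using e2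
    have e3' : deriv Y t = 0 := by simpa [hr0] using e3
    have := himm t ht F G hF hG (0, 1) hF0 (by
      rw [hG', e1', e2', e3']; simpa using B.vec_zero)
    simp at this
  refine ⟨r, x, y, R, X, Y, ⟨hrs, hxs, hys, hRs, hXs, hYs, fun t ht => ?_, fun t ht => ?_,
    fun t ht => ?_, fun t ht => (hnormal t ht).1, fun t ht => (hnormal t ht).2,
    fun t ht => (hpoint t ht).1, fun t ht => (hpoint t ht).2.1, fun t ht => (hpoint t ht).2.2.1,
    fun t ht => (hpoint t ht).2.2.2, hspeed⟩, hfs, hgs⟩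
  all_goals
    have hfm := h.f_section.mem _ (hD0 ht)
    have hgm := h.g_section.mem _ (hD0 ht)
  · have e := h.null _ (hD0 ht) _ hfm _ hfm
    rw [hf0 t ht, B.ip_vec_vec] at e
    rw [hΔ]; linear_combination e
  · have e := h.null _ (hD0 ht) _ hgm _ hgm
    rw [hg0 t ht, B.ip_vec_vec] at e
    rw [hΔ]; linear_combination e
  · have e := h.null _ (hD0 ht) _ hfm _ hgm
    rw [hf0 t ht, hg0 t ht, B.ip_vec_vec] at e
    rw [hΔ]; linear_combination e

/-! ### The Christoffel dual pair -/

lemma IsDualProfile.exists_const {B : AdaptedFrame} {I : Set ℝ} {r x y R X Y : ℝ → ℝ}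
    (h : IsDualProfile B I r x y R X Y) (hI : IsOpen I) (hIc : I.OrdConnected) :
    ∃ C : ℝ, ∀ t ∈ I, r t * R t = C := by
  have hd : ∀ t ∈ I, HasDerivAt (fun t => r t * R t) 0 t := by
    intro t ht
    convert! (hasDerivAt_of_contDiffOn hI h.r_smooth ht).mul
      (hasDerivAt_of_contDiffOn hI h.R_smooth ht) using 1
    linear_combination (-1 : ℝ) * h.dual_r t ht
  exact hI.exists_is_const_of_deriv_eq_zero hIc.isPreconnected
    (fun t ht => (hd t ht).differentiableAt.differentiableWithinAt) fun t ht => (hd t ht).deriv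

/-- Dual profile curves have a common conformal parameter, for which the speed is the radius. -/
lemma IsDualProfile.exists_conformal {B : AdaptedFrame} {I : Set ℝ} {r x y R X Y : ℝ → ℝ}
    (h : IsDualProfile B I r x y R X Y) (hI : IsOpen I) (hIc : I.OrdConnected)
    (hIn : I.Nonempty) :
    ∃ (J : Set ℝ) (φ : ℝ → ℝ), IsOpen J ∧ J.OrdConnected ∧ ContDiffOn ℝ ∞ φ J ∧
      Set.BijOn φ J I ∧ (∀ τ ∈ J, 0 < deriv φ τ) ∧
      IsDualProfile B J (r ∘ φ) (x ∘ φ) (y ∘ φ) (R ∘ φ) (X ∘ φ) (Y ∘ φ) ∧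
      ∀ τ ∈ J, B.κ₁ * deriv (r ∘ φ) τ ^ 2 + B.κ₂ * deriv (x ∘ φ) τ ^ 2 + deriv (y ∘ φ) τ ^ 2
        = (r ∘ φ) τ ^ 2 := by
  set N : ℝ → ℝ := fun t => B.κ₁ * deriv r t ^ 2 + B.κ₂ * deriv x t ^ 2 + deriv y t ^ 2 with hN
  have hNs : ContDiffOn ℝ ∞ N I :=
    ((contDiffOn_const.mul ((contDiffOn_deriv hI h.r_smooth).pow 2)).add
      (contDiffOn_const.mul ((contDiffOn_deriv hI h.x_smooth).pow 2))).add
      ((contDiffOn_deriv hI h.y_smooth).pow 2)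
  have hpos : ∀ t ∈ I, 0 < r t ^ 2 / N t := fun t ht =>
    div_pos (pow_pos (abs_pos.2 (h.r_ne_zero t ht)) 2 |>.trans_eq (sq_abs _)) (h.speed_pos t ht)
  -- the derivative of the reparametrization is the radius divided by the speed
  obtain ⟨J, φ, hJ, hJc, hφ, hbij, hφ'⟩ := exists_reparametrization hI hIc hIn
    (h := fun t => Real.sqrt (r t ^ 2 / N t))
    (((h.r_smooth.pow 2).div hNs fun t ht => (h.speed_pos t ht).ne').sqrt
      fun t ht => (hpos t ht).ne')
    (fun t ht => Real.sqrt_pos.2 (hpos t ht))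
  have hmap := hbij.mapsTo
  have hq : ∀ τ ∈ J, 0 < deriv φ τ ∧ deriv φ τ ^ 2 * N (φ τ) = r (φ τ) ^ 2 := by
    intro τ hτ
    have hp := hpos _ (hmap hτ)
    rw [(hφ' τ hτ).deriv]
    refine ⟨Real.sqrt_pos.2 hp, ?_⟩
    rw [Real.sq_sqrt hp.le, div_mul_cancel₀ _ (h.speed_pos _ (hmap hτ)).ne']
  have hc : ∀ {k : ℝ → ℝ}, ContDiffOn ℝ ∞ k I → ∀ τ ∈ J,
      deriv (k ∘ φ) τ = deriv k (φ τ) * deriv φ τ := fun {k} hk τ hτ =>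
    ((hasDerivAt_of_contDiffOn hI hk (hmap hτ)).comp τ
      (hasDerivAt_of_contDiffOn hJ hφ hτ)).deriv
  have hr := hc h.r_smooth
  have hx := hc h.x_smooth
  have hy := hc h.y_smooth
  have hR := hc h.R_smooth
  have hX := hc h.X_smooth
  have hY := hc h.Y_smooth
  have hunit : ∀ τ ∈ J, B.κ₁ * deriv (r ∘ φ) τ ^ 2 + B.κ₂ * deriv (x ∘ φ) τ ^ 2
      + deriv (y ∘ φ) τ ^ 2 = (r ∘ φ) τ ^ 2 := by
    intro τ hτ
    rw [hr τ hτ, hx τ hτ, hy τ hτ, Function.comp_apply, ← (hq τ hτ).2]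
    simp only [hN]; ring
  refine ⟨J, φ, hJ, hJc, hφ, hbij, fun τ hτ => (hq τ hτ).1, ?_, hunit⟩
  exact
    { r_smooth := h.r_smooth.comp hφ hmap
      x_smooth := h.x_smooth.comp hφ hmap
      y_smooth := h.y_smooth.comp hφ hmap
      R_smooth := h.R_smooth.comp hφ hmap
      X_smooth := h.X_smooth.comp hφ hmap
      Y_smooth := h.Y_smooth.comp hφ hmap
      norm_f := fun τ hτ => h.norm_f _ (hmap hτ)
      norm_g := fun τ hτ => h.norm_g _ (hmap hτ)
      ip_f_g := fun τ hτ => h.ip_f_g _ (hmap hτ)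
      normal_f := fun τ hτ => by
        rw [hr τ hτ, hx τ hτ, hy τ hτ]
        simp only [Function.comp_apply]
        linear_combination deriv φ τ * h.normal_f _ (hmap hτ)
      normal_g := fun τ hτ => by
        rw [hr τ hτ, hx τ hτ, hy τ hτ]
        simp only [Function.comp_apply]
        linear_combination deriv φ τ * h.normal_g _ (hmap hτ)
      r_ne_zero := fun τ hτ => h.r_ne_zero _ (hmap hτ)
      dual_r := fun τ hτ => by
        rw [hr τ hτ, hR τ hτ]
        simp only [Function.comp_apply]
        linear_combination deriv φ τ * h.dual_r _ (hmap hτ)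
      dual_x := fun τ hτ => by
        rw [hx τ hτ, hX τ hτ]
        simp only [Function.comp_apply]
        linear_combination deriv φ τ * h.dual_x _ (hmap hτ)
      dual_y := fun τ hτ => by
        rw [hy τ hτ, hY τ hτ]
        simp only [Function.comp_apply]
        linear_combination deriv φ τ * h.dual_y _ (hmap hτ)
      speed_pos := fun τ hτ => by
        rw [hunit τ hτ]
        exact pow_pos (abs_pos.2 (h.r_ne_zero _ (hmap hτ))) 2 |>.trans_eq (sq_abs _) }

lemma IsDualProfile.areChristoffelDual {B : AdaptedFrame} {J : Set ℝ} {r x y R X Y : ℝ → ℝ}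
    (h : IsDualProfile B J r x y R X Y) (hJ : IsOpen J)
    (hunit : ∀ τ ∈ J, B.κ₁ * deriv r τ ^ 2 + B.κ₂ * deriv x τ ^ 2 + deriv y τ ^ 2 = r τ ^ 2)
    {C : ℝ} (hC : ∀ τ ∈ J, r τ * R τ = C) {F G : ℝ × ℝ → R42}
    (hF : ∀ p ∈ (Set.univ ×ˢ J : Set (ℝ × ℝ)), F p = B.surface (-B.ε) B.κp r x y p)
    (hG : ∀ p ∈ (Set.univ ×ˢ J : Set (ℝ × ℝ)), G p = B.surface B.κm (-B.ε) R X Y p) :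
    AreChristoffelDual (Set.univ ×ˢ J) F G C (fun _ => 1) (fun _ => 1) := by
  have hD : IsOpen (Set.univ ×ˢ J : Set (ℝ × ℝ)) := isOpen_univ.prod hJ
  have hpd : ∀ {a b : ℝ} {r x y : ℝ → ℝ} {F : ℝ × ℝ → R42}, ContDiffOn ℝ ∞ r J →
      ContDiffOn ℝ ∞ x J → ContDiffOn ℝ ∞ y J →
      (∀ p ∈ (Set.univ ×ˢ J : Set (ℝ × ℝ)), F p = B.surface a b r x y p) →
      ∀ p ∈ (Set.univ ×ˢ J : Set (ℝ × ℝ)),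
        pd1 F p = B.vec 0 0 (-(r p.2 * (B.κ₁ * ksin B.κ₁ p.1))) (r p.2 * kcos B.κ₁ p.1) 0 0 ∧
        pd2 F p = B.vec 0 0 (deriv r p.2 * kcos B.κ₁ p.1) (deriv r p.2 * ksin B.κ₁ p.1)
          (deriv x p.2) (deriv y p.2) := by
    rintro a b r x y F hr hx hy hF ⟨θ, t⟩ hp
    obtain ⟨L, hL, hL'⟩ := B.exists_hasFDerivAt_surface (a := a) (b := b) (θ := θ)
      (hasDerivAt_of_contDiffOn hJ hr hp.2) (hasDerivAt_of_contDiffOn hJ hx hp.2)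
      (hasDerivAt_of_contDiffOn hJ hy hp.2)
    have hFL : HasFDerivAt F L (θ, t) := hL.congr_of_eventuallyEq (by
      filter_upwards [hD.mem_nhds hp] with w hw using hF w hw)
    rw [pd1, pd2, hFL.fderiv, hL', hL']
    simp
  have hFd := hpd h.r_smooth h.x_smooth h.y_smooth hF
  have hGd := hpd h.R_smooth h.X_smooth h.Y_smooth hG
  have hκ := B.κ₁_mul_self
  have n1 : ∀ p ∈ (Set.univ ×ˢ J : Set (ℝ × ℝ)), ip (pd1 F p) (pd1 F p) = r p.2 ^ 2 := by
    intro p hp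
    rw [(hFd p hp).1, B.ip_vec_vec]
    linear_combination r p.2 ^ 2 * kcos_sq_add B.sign₁ p.1
      + r p.2 ^ 2 * B.κ₁ * ksin B.κ₁ p.1 ^ 2 * hκ
  have n2 : ∀ p ∈ (Set.univ ×ˢ J : Set (ℝ × ℝ)), ip (pd2 F p) (pd2 F p) = r p.2 ^ 2 := by
    intro p hp
    rw [(hFd p hp).2, B.ip_vec_vec]
    linear_combination hunit p.2 hp.2 + B.κ₁ * deriv r p.2 ^ 2 * kcos_sq_add B.sign₁ p.1
      - deriv r p.2 ^ 2 * ksin B.κ₁ p.1 ^ 2 * hκ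
  have hr2 : ∀ p ∈ (Set.univ ×ˢ J : Set (ℝ × ℝ)), r p.2 ^ 2 ≠ 0 := fun p hp =>
    pow_ne_zero 2 (h.r_ne_zero _ hp.2)
  have hquot : ∀ p ∈ (Set.univ ×ˢ J : Set (ℝ × ℝ)), C / r p.2 ^ 2 = R p.2 / r p.2 := by
    intro p hp
    have := h.r_ne_zero _ hp.2
    rw [← hC _ hp.2]; field_simp
  refine ⟨fun p hp => ⟨?_, one_ne_zero⟩, fun p hp => ⟨?_, one_ne_zero⟩, fun p hp => ?_,
    fun p hp => ?_, fun p hp => by rw [n1 p hp, n2 p hp]⟩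
  · rw [n1 p hp]; exact hr2 p hp
  · rw [n2 p hp]; exact hr2 p hp
  · have hr0 := h.r_ne_zero _ hp.2
    rw [n1 p hp, mul_one, hquot p hp, (hFd p hp).1, (hGd p hp).1, B.smul_vec]
    congr 1 <;> field_simp <;> ring
  · have hr0 := h.r_ne_zero _ hp.2
    have e1 : deriv R p.2 = -(R p.2 / r p.2) * deriv r p.2 := by
      have := h.dual_r _ hp.2
      field_simp; linear_combination this
    have e2 : deriv X p.2 = -(R p.2 / r p.2) * deriv x p.2 := by
      have := h.dual_x _ hp.2
      field_simp; linear_combination this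
    have e3 : deriv Y p.2 = -(R p.2 / r p.2) * deriv y p.2 := by
      have := h.dual_y _ hp.2
      field_simp; linear_combination this
    rw [n2 p hp, mul_one, neg_div, hquot p hp, (hFd p hp).2, (hGd p hp).2, B.smul_vec, e1, e2, e3]
    congr 1 <;> ring

/-! ### The frame of a rotational linear Weingarten surface -/

lemma exists_adaptedFrame {p q pp pm v₁ e₁ v₂ e₂ : R42} {κ₁ κ₂ : ℝ}
    (hpq : IsSpaceForm p q) (hflat : ip q q ≠ 0)
    (hP₁ : IsRotationPlane p q v₁ e₁ κ₁) (hP₂ : IsRotationPlane p q v₂ e₂ κ₂)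
    (hvv : ip v₁ v₂ = 0) (hve : ip v₁ e₂ = 0) (hev : ip e₁ v₂ = 0) (hee : ip e₁ e₂ = 0)
    (hspan : Submodule.span ℝ {pp, pm} = Submodule.span ℝ {p, q}) :
    ∃ B : AdaptedFrame, pp = B.pp ∧ pm = B.pm ∧ v₁ = B.v₁ ∧ e₁ = B.e₁ ∧ v₂ = B.v₂ ∧ e₂ = B.e₂ ∧
      κ₁ = B.κ₁ ∧ κ₂ = B.κ₂ := by
  have hk : ∀ {κ : ℝ}, κ = 1 ∨ κ = -1 → κ ≠ 0 := by rintro κ (rfl | rfl) <;> norm_num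
  have mem_pq : ∀ {w : R42}, w ∈ Submodule.span ℝ {pp, pm} → ∀ {z : R42}, ip z p = 0 →
      ip z q = 0 → ip z w = 0 := by
    intro w hw z hp hq
    rw [hspan, Submodule.mem_span_pair] at hw
    obtain ⟨a, b, rfl⟩ := hw
    rw [ip_add_right, ip_smul_right, ip_smul_right, hp, hq]; ring
  have hpp : pp ∈ Submodule.span ℝ {pp, pm} := Submodule.subset_span (by simp)
  have hpm : pm ∈ Submodule.span ℝ {pp, pm} := Submodule.subset_span (by simp)
  have hp : p ∈ Submodule.span ℝ {pp, pm} := hspan ▸ Submodule.subset_span (by simp)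
  have hq : q ∈ Submodule.span ℝ {pp, pm} := hspan ▸ Submodule.subset_span (by simp)
  obtain ⟨a, b, hab⟩ := Submodule.mem_span_pair.1 hp
  obtain ⟨c, d, hcd⟩ := Submodule.mem_span_pair.1 hq
  obtain ⟨hpos, hcomplete⟩ := orthogonal_sextuple ![p, q, v₁, e₁, v₂, e₂]
    ![-1, ip q q, κ₁, 1, κ₂, 1]
    (by simp [Fin.prod_univ_six, hflat, hk hP₁.sign, hk hP₂.sign])
    (by
      intro i j
      fin_cases i <;> fin_cases j <;>
        simp [hpq.unit_timelike, hpq.perp, ip_comm q p, hP₁.vv, hP₁.ee, hP₁.ve, hP₁.vp, hP₁.vq,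
          hP₁.ep, hP₁.eq, hP₂.vv, hP₂.ee, hP₂.ve, hP₂.vp, hP₂.vq, hP₂.ep, hP₂.eq, hvv, hve, hev,
          hee, ip_comm p v₁, ip_comm q v₁, ip_comm p e₁, ip_comm q e₁, ip_comm p v₂, ip_comm q v₂,
          ip_comm p e₂, ip_comm q e₂, ip_comm e₁ v₁, ip_comm v₂ v₁, ip_comm e₂ v₁, ip_comm v₂ e₁,
          ip_comm e₂ e₁, ip_comm e₂ v₂])
  simp only [Fin.prod_univ_six] at hpos
  have hpos' : 0 < -ip q q * κ₁ * κ₂ := by simpa using hpos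
  -- the Gram determinants of the two bases of the plane differ by a square
  have hgram : -ip q q = (a * d - b * c) ^ 2 * (ip pp pp * ip pm pm - ip pp pm ^ 2) := by
    have h1 : ip p p * ip q q - ip p q ^ 2 = -ip q q := by
      rw [hpq.unit_timelike, hpq.perp]; ring
    rw [← h1, ← hab, ← hcd]
    simp only [ip_add_left, ip_add_right, ip_smul_left, ip_smul_right, ip_comm pm pp]
    ring
  have hsign : 0 < κ₁ * κ₂ / (ip pp pp * ip pm pm - ip pp pm ^ 2) := by
    rw [hgram] at hpos'
    have h1 : 0 < (a * d - b * c) ^ 2 * (κ₁ * κ₂ * (ip pp pp * ip pm pm - ip pp pm ^ 2)) := by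
      linarith
    have h2 := pos_of_mul_pos_right h1 (sq_nonneg _)
    rw [div_eq_mul_inv]
    rcases lt_trichotomy (ip pp pp * ip pm pm - ip pp pm ^ 2) 0 with h | h | h
    · exact mul_pos_of_neg_of_neg (by nlinarith) (inv_lt_zero.2 h)
    · rw [h] at h2; simp at h2
    · exact mul_pos (by nlinarith) (inv_pos.2 h)
  refine ⟨
    { pp := pp, pm := pm, v₁ := v₁, e₁ := e₁, v₂ := v₂, e₂ := e₂, κ₁ := κ₁, κ₂ := κ₂
      κp := ip pp pp, κm := ip pm pm, ε := ip pp pm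
      sign₁ := hP₁.sign, sign₂ := hP₂.sign, pp_pp := rfl, pm_pm := rfl, pp_pm := rfl
      v₁_v₁ := hP₁.vv, e₁_e₁ := hP₁.ee, v₂_v₂ := hP₂.vv, e₂_e₂ := hP₂.ee, v₁_e₁ := hP₁.ve
      v₂_e₂ := hP₂.ve, v₁_v₂ := hvv, v₁_e₂ := hve, e₁_v₂ := hev, e₁_e₂ := hee
      v₁_pp := mem_pq hpp hP₁.vp hP₁.vq, v₁_pm := mem_pq hpm hP₁.vp hP₁.vq
      e₁_pp := mem_pq hpp hP₁.ep hP₁.eq, e₁_pm := mem_pq hpm hP₁.ep hP₁.eq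
      v₂_pp := mem_pq hpp hP₂.vp hP₂.vq, v₂_pm := mem_pq hpm hP₂.vp hP₂.vq
      e₂_pp := mem_pq hpp hP₂.ep hP₂.eq, e₂_pm := mem_pq hpm hP₂.ep hP₂.eq
      pos := hsign
      complete := fun z h1 h2 h3 h4 h5 h6 => hcomplete z fun i => ?_ }, rfl, rfl, rfl, rfl, rfl,
        rfl, rfl, rfl⟩
  fin_cases i
  · simp [← hab, ip_add_right, ip_smul_right, h1, h2]
  · simp [← hcd, ip_add_right, ip_smul_right, h1, h2]
  · exact h3
  · exact h4
  · exact h5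
  · exact h6

/-- The normalized lifts of a linear Weingarten surface. -/
lemma IsLinearWeingarten.exists_normalizedPair {D : Set (ℝ × ℝ)} {p q : R42} {B : AdaptedFrame}
    {Λ sp sm : ℝ × ℝ → Submodule ℝ R42} (hLW : IsLinearWeingarten D p q B.pp B.pm Λ sp sm)
    (hpq : IsSpaceForm p q) :
    ∃ f g, IsLift D sp f ∧ IsLift D sm g ∧ IsNormalizedPair B D Λ f g := by
  obtain ⟨f₀, hf₀, hf₀pq⟩ := hLW.spaceFormLift
  have hnull := hLW.omega.legendre.null
  have hperp : ∀ x ∈ D, ∀ w ∈ Λ x, ip w B.pp = 0 → ip w B.pm = 0 → w = 0 := by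
    intro x hx w hw hp hm
    have hz : ∀ z ∈ Submodule.span ℝ {p, q}, ip w z = 0 := by
      intro z hz
      rw [← hLW.span_eq, Submodule.mem_span_pair] at hz
      obtain ⟨a, b, rfl⟩ := hz
      rw [ip_add_right, ip_smul_right, ip_smul_right, hp, hm]; ring
    have hfm := hf₀.mem x hx
    exact eq_zero_of_perp_spaceForm hpq.unit_timelike (hnull x hx _ hfm _ hfm)
      (hnull x hx _ hw _ hw) (hnull x hx _ hw _ hfm) (hf₀pq x hx).1 (hf₀pq x hx).2
      (hz p (Submodule.subset_span (by simp))) (hz q (Submodule.subset_span (by simp)))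
  obtain ⟨σ, hσ⟩ := hLW.omega.congruence₁
  obtain ⟨τ, hτ⟩ := hLW.omega.congruence₂
  have hsp : ∀ x ∈ D, sp x ≤ Λ x := fun x hx => by
    rw [hLW.omega.spanned x hx]; exact le_sup_left
  have hsm : ∀ x ∈ D, sm x ≤ Λ x := fun x hx => by
    rw [hLW.omega.spanned x hx]; exact le_sup_right
  have mem : ∀ {s : ℝ × ℝ → Submodule ℝ R42} {σ : ℝ × ℝ → R42}, IsLift D s σ → ∀ x ∈ D,
      σ x ∈ s x := fun {s σ} h x hx => by
    rw [h.spans x hx]; exact Submodule.mem_span_singleton_self _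
  have hσm : ∀ x ∈ D, ip (σ x) B.pm ≠ 0 := fun x hx h0 => hσ.ne_zero x hx
    (hperp x hx _ (hsp x hx (mem hσ x hx)) (hLW.complex_p x hx _ (mem hσ x hx)) h0)
  have hτp : ∀ x ∈ D, ip (τ x) B.pp ≠ 0 := fun x hx h0 => hτ.ne_zero x hx
    (hperp x hx _ (hsm x hx (mem hτ x hx)) h0 (hLW.complex_m x hx _ (mem hτ x hx)))
  have hf := hσ.normalize hσm B.Δ_ne_zero
  have hg := hτ.normalize hτp B.Δ_ne_zero
  refine ⟨_, _, hf, hg, ⟨hf.smooth, fun x hx => hsp x hx (mem hf x hx)⟩,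
    ⟨hg.smooth, fun x hx => hsm x hx (mem hg x hx)⟩, hnull,
    fun x hx => hLW.complex_p x hx _ (mem hf x hx), fun x hx => ?_, fun x hx => ?_,
    fun x hx => hLW.complex_m x hx _ (mem hg x hx), hperp⟩
  · rw [ip_smul_left, div_mul_cancel₀ _ (hσm x hx)]
  · rw [ip_smul_left, div_mul_cancel₀ _ (hτp x hx)]

end LieSphere

end

theorem mainTheorem8
    (p q pp pm v₁ e₁ v₂ e₂ : LieSphere.R42) (κ₁ κ₂ κp κm ε Δ : ℝ)
    (I : Set ℝ) (Λ sp sm : ℝ × ℝ → Submodule ℝ LieSphere.R42)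
    -- a non-flat space form
    (hpq : LieSphere.IsSpaceForm p q) (hflat : LieSphere.ip q q ≠ 0)
    -- the rotation plane and its complement, both non-degenerate
    (hP₁ : LieSphere.IsRotationPlane p q v₁ e₁ κ₁)
    (hP₂ : LieSphere.IsRotationPlane p q v₂ e₂ κ₂)
    (hvv : LieSphere.ip v₁ v₂ = 0) (hve : LieSphere.ip v₁ e₂ = 0)
    (hev : LieSphere.ip e₁ v₂ = 0) (hee : LieSphere.ip e₁ e₂ = 0)
    -- the parameter interval
    (hIo : IsOpen I) (hIc : I.OrdConnected) (hIn : I.Nonempty)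
    -- a rotational linear Weingarten surface with real sphere complexes
    (hLW : LieSphere.IsLinearWeingarten (Set.univ ×ˢ I) p q pp pm Λ sp sm)
    (hrot : LieSphere.IsRotational I v₁ e₁ κ₁ Λ)
    -- the entries of the multiplication table
    (hκp : κp = LieSphere.ip pp pp) (hκm : κm = LieSphere.ip pm pm)
    (hε : ε = LieSphere.ip pp pm) (hΔ : Δ = κp * κm - ε ^ 2)
    (hκm0 : κm ≠ 0)
    -- the component of `s⁺` in the plane of `v₂, e₂` has the causal character of `v₂`
    (hcausal : ∀ x ∈ (Set.univ ×ˢ I : Set (ℝ × ℝ)), ∀ w ∈ sp x, w ≠ 0 →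
      0 < κ₂ * LieSphere.ip (LieSphere.planePart v₂ e₂ κ₂ w)
        (LieSphere.planePart v₂ e₂ κ₂ w)) :
    -- the normalized lifts `s⁺, s⁻`
    ∃ (f g : ℝ × ℝ → LieSphere.R42) (C : ℝ),
      LieSphere.IsLift (Set.univ ×ˢ I) sp f ∧ LieSphere.IsLift (Set.univ ×ˢ I) sm g ∧
      (∀ x ∈ (Set.univ ×ˢ I : Set (ℝ × ℝ)),
        LieSphere.ip (f x) pp = 0 ∧ LieSphere.ip (f x) pm = Δ ∧
        LieSphere.ip (g x) pm = 0 ∧ LieSphere.ip (g x) pp = Δ) ∧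
      -- a reparametrization `t = φ(τ)` of the profile curve
      ∃ (J : Set ℝ) (φ : ℝ → ℝ),
        IsOpen J ∧ J.OrdConnected ∧ ContDiffOn ℝ ∞ φ J ∧ Set.BijOn φ J I ∧
        (∀ τ ∈ J, 0 < deriv φ τ) ∧
        -- they are Christoffel dual with constant `C`
        LieSphere.AreChristoffelDual (Set.univ ×ˢ J)
          (fun x => f (x.1, φ x.2)) (fun x => g (x.1, φ x.2)) C (fun _ => 1) (fun _ => 1) ∧
        -- polar coordinates; `σ` orients the rotations in the plane of `v₂, e₂`
        ∃ (σ : ℝ) (r ψ d : ℝ → ℝ), (σ = 1 ∨ σ = -1) ∧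
          ContDiffOn ℝ ∞ r J ∧ ContDiffOn ℝ ∞ ψ J ∧ ContDiffOn ℝ ∞ d J ∧
          (∀ θ : ℝ, ∀ τ ∈ J,
            f (θ, φ τ) = LieSphere.rot v₁ e₁ κ₁ θ (LieSphere.rot v₂ (σ • e₂) κ₂ (ψ τ)
              ((-ε) • pp + κp • pm + r τ • v₁ + d τ • v₂))) ∧
          -- the system, with the roots `C₁, C₂` of the quadratic polynomial `p_C`
          (∃ C₁ C₂ : ℂ, (LieSphere.polyC κ₁ κp κm ε Δ C).aroots ℂ = {C₁, C₂} ∧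
            (¬ (0 < κp ∧ 0 < κm) → C₁.im = 0 ∧ C₂.im = 0) ∧
            ∀ τ ∈ J, ((deriv r τ : ℝ) : ℂ) ^ 2 =
              (κm : ℂ) / (Δ : ℂ) ^ 2 * ((r τ : ℂ) ^ 2 - C₁) * ((r τ : ℂ) ^ 2 - C₂)) ∧
          (∀ τ ∈ J, κp * Δ + κ₁ * r τ ^ 2 ≠ 0 ∧
            deriv ψ τ = Real.sqrt (κ₁ * κ₂ / Δ) *
              ((ε * r τ ^ 2 + κp * C) / (κp * Δ + κ₁ * r τ ^ 2))) ∧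
          (∀ τ ∈ J, d τ ^ 2 = -((κp * Δ + κ₁ * r τ ^ 2) / κ₂)) := by
  obtain ⟨B, rfl, rfl, rfl, rfl, rfl, rfl, rfl, rfl⟩ :=
    LieSphere.exists_adaptedFrame hpq hflat hP₁ hP₂ hvv hve hev hee hLW.span_eq
  rw [B.pp_pp] at hκp
  rw [B.pm_pm] at hκm
  rw [B.pp_pm] at hε
  subst hκp hκm hε
  obtain rfl : Δ = B.Δ := hΔ
  have hΔ0 := B.Δ_ne_zero
  obtain ⟨f, g, hf, hg, hfg⟩ := hLW.exists_normalizedPair hpq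
  obtain ⟨r, x, y, R, X, Y, hprof, hfs, hgs⟩ :=
    LieSphere.exists_dualProfile hIo hLW.omega.legendre hLW.omega.harmonic hf hg hfg hrot
  obtain ⟨J, φ, hJ, hJc, hφ, hbij, hφ', hprofJ, hunit⟩ := hprof.exists_conformal hIo hIc hIn
  have hJn : J.Nonempty := by
    obtain ⟨t, ht⟩ := hIn
    obtain ⟨τ, hτ, -⟩ := hbij.surjOn ht
    exact ⟨τ, hτ⟩
  obtain ⟨C, hC⟩ := hprofJ.exists_const hJ hJc
  have hmap : ∀ {p : ℝ × ℝ}, p ∈ (Set.univ ×ˢ J : Set (ℝ × ℝ)) →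
      (p.1, φ p.2) ∈ (Set.univ ×ˢ I : Set (ℝ × ℝ)) := fun hp => ⟨trivial, hbij.mapsTo hp.2⟩
  have hpos : ∀ τ ∈ J, 0 < B.κ₂ * (B.κ₂ * (x ∘ φ) τ ^ 2 + (y ∘ φ) τ ^ 2) := by
    intro τ hτ
    have hD : ((0 : ℝ), φ τ) ∈ (Set.univ ×ˢ I : Set (ℝ × ℝ)) := ⟨trivial, hbij.mapsTo hτ⟩
    have h := hcausal _ hD (f (0, φ τ))
      (by rw [hf.spans _ hD]; exact Submodule.mem_span_singleton_self _) (hf.ne_zero _ hD)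
    have e : LieSphere.planePart B.v₂ B.e₂ B.κ₂ (f (0, φ τ))
        = B.vec 0 0 0 0 (x (φ τ)) (y (φ τ)) := by
      rw [hfs _ hD, LieSphere.planePart, LieSphere.AdaptedFrame.surface, B.ip_vec_v₂, B.ip_vec_e₂,
        show B.κ₂ * (B.κ₂ * x (φ τ)) = x (φ τ) by
          linear_combination x (φ τ) * B.κ₂_mul_self]
      simp [LieSphere.AdaptedFrame.vec]
    rw [e, B.ip_vec_vec] at h
    convert! h using 2
    simp only [Function.comp_apply]; ring
  obtain ⟨σ, ψ, d, hσ, hψ, hd, hpolar⟩ := LieSphere.exists_polar_profile B.sign₁ B.sign₂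
    (rfl : B.Δ = B.κp * B.κm - B.ε ^ 2) B.pos hJ hJc hJn
    hprofJ.r_smooth hprofJ.x_smooth hprofJ.y_smooth hprofJ.R_smooth hprofJ.X_smooth
    hprofJ.Y_smooth hprofJ.norm_f hprofJ.norm_g hprofJ.ip_f_g hprofJ.normal_f hprofJ.normal_g hC
    hprofJ.r_ne_zero hunit hpos
  refine ⟨f, g, C, hf, hg,
    fun p hp => ⟨hfg.f_pp p hp, hfg.f_pm p hp, hfg.g_pm p hp, hfg.g_pp p hp⟩,
    J, φ, hJ, hJc, hφ, hbij, hφ', ?_, σ, r ∘ φ, ψ, d, hσ, hprofJ.r_smooth, hψ, hd, ?_, ?_,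
    fun τ hτ => ⟨(hpolar τ hτ).2.2.1, (hpolar τ hτ).2.2.2.1⟩,
    fun τ hτ => (hpolar τ hτ).2.2.2.2.1⟩
  · exact hprofJ.areChristoffelDual hJ hunit hC (fun p hp => hfs _ (hmap hp))
      fun p hp => hgs _ (hmap hp)
  · intro θ τ hτ
    have e : (-B.ε) • B.pp + B.κp • B.pm + (r ∘ φ) τ • B.v₁ + d τ • B.v₂
        = B.vec (-B.ε) B.κp ((r ∘ φ) τ) 0 (d τ) 0 := by
      simp [LieSphere.AdaptedFrame.vec]
    rw [e, B.rot₂_vec, ← (hpolar τ hτ).1, ← (hpolar τ hτ).2.1, B.rot₁_vec]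
    exact hfs _ ⟨trivial, hbij.mapsTo hτ⟩
  · exact LieSphere.exists_roots_polyC B.sign₁ hκm0 hΔ0 hJn
      fun τ hτ => (hpolar τ hτ).2.2.2.2.2
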